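/- Let $M$ be an $(n+1)$-dimensional smooth manifold and let $\mathscr{L}\colon TM\setminus 0\to\mathbb{R}$ be a Lorentz–Finsler Lagrangian of class $C^4$: $\mathscr{L}(x,sv)=s^2\mathscr{L}(x,v)$ for $s>0$, and $g_{\mu\nu}(x,v)=\partial^2\mathscr{L}/\partial v^\mu\partial v^\nu$ has signature $(-,+,\dots,+)$ for every $v\neq0$; write $g_v$ for this metric. Let $$2G^\alpha=g^{\alpha\delta}\Big(\frac{\partial^2\mathscr{L}}{\partial x^\gamma\partial v^\delta}v^\gamma-\frac{\partial\mathscr{L}}{\partial x^\delta}\Big),\quad N^\mu_\alpha=\frac{\partial G^\mu}{\partial v^\alpha},\quad \frac{\delta}{\delta x^\mu}=\frac{\partial}{\partial x^\mu}-N^\nu_\mu\frac{\partial}{\partial v^\nu},\quad R^\mu_{\alpha\beta}=\frac{\delta N^\mu_\beta}{\delta x^\alpha}-\frac{\delta N^\mu_\alpha}{\delta x^\beta},$$ let $R_v$ be the endomorphism $(R_v)^\alpha_\beta=R^\alpha_{\beta\mu}(x,v)v^\mu$ of $T_xM$ and $\mathrm{Ric}(v)=\mathrm{tr}\,R_v$.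 For vector fields $u$ (nowhere zero) and $Y$ put $$D_Xu^\alpha=\big(\partial_\mu u^\alpha+N^\alpha_\mu(x,u)\big)X^\mu,\qquad \tilde D_uY^\alpha=u^\mu\partial_\mu Y^\alpha+N^\alpha_\mu(x,u)Y^\mu;$$ $\tilde D_uY$ is also defined for a field $Y$ given only along an integral curve of $u$. Let $H$ be a $C^2$ spacelike hypersurface and let $u$ be a $C^1$ vector field on an open set $U\supset H$ which is timelike, normalized, geodesic and orthogonal to $H$: $g_u(u,u)=-1$ and $D_uu=0$ on $U$, and $\ker g_u(u,\cdot)=T_pH$ for $p\in H$. Over $U$ let $V_p=\ker g_u(u,\cdot)\subset T_pM$, let $P\colon T_pM\to V_p$ be the projection with kernel $\mathrm{Span}(u)$, and for sections $X$ and endomorphisms $A$ of $V$ along the integral curves of $u$ put $X'=P(\tilde D_uX)$ and $A'(X)=(A(X))'-A(X')$; for functions, a prime is the derivative along the integral curves. Then $D_Xu\in V_p$ and $R_u(X)\in V_p$ for every $X\in V_p$, so that the Weingarten map $b(X)=D_Xu$ and $\bar R(X)=R_u(X)$ are endomorphisms of $V_p$. Let $\theta=\mathrm{tr}\,b$, $\bar\sigma=b-\frac1n\theta\,\mathrm{Id}$,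 $\sigma^2=\mathrm{tr}\,\bar\sigma^2$ and $\bar Q=\bar R-\frac1n\mathrm{tr}\bar R\,\mathrm{Id}$. Along every integral curve of $u$ in $U$, the maps $b$, $\theta$, $\bar\sigma$ are differentiable and $$b'=-\bar R-b^2,$$ $$\theta'=-\mathrm{Ric}(u)-\sigma^2-\frac1n\theta^2,$$ $$\bar\sigma'=-\bar Q-\Big(\bar\sigma^2-\frac1n\mathrm{tr}\,\bar\sigma^2\,\mathrm{Id}\Big)-\frac2n\theta\,\bar\sigma.$$ -/

import Mathlib

open scoped Manifold ContDiff

noncomputable section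

namespace FinslerRaychaudhuri

/-! ## Local coordinate expressions

`l y w` is the Lagrangian in a chart of `M` and the induced chart of `TM`; `y` is the position and
`w` the velocity. Indices are contracted, so that one-index objects are vectors or covectors of
`E`, and so on. -/

section Coordinates

variable {E : Type*} [NormedAddCommGroup E] [NormedSpace ℝ E]

/-- `g_{μν}(y, w) = ∂²l / ∂v^μ ∂v^ν`. -/
def metricC (l : E → E → ℝ) (y w : E) : E →L[ℝ] E →L[ℝ] ℝ :=
  fderiv ℝ (fun w' : E => fderiv ℝ (l y) w') w

/-- The covector `∂²l/∂x^γ∂v^δ v^γ - ∂l/∂x^δ` at `(y, w)`. -/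
def sprayCovectorC (l : E → E → ℝ) (y w : E) : E →L[ℝ] ℝ :=
  fderiv ℝ (fun x : E => fderiv ℝ (l x) w) y w - fderiv ℝ (fun x : E => l x w) y

/-- The spray coefficients `G^α`, where
`2 G^α = g^{αδ} (∂²l/∂x^γ∂v^δ v^γ - ∂l/∂x^δ)`. -/
def sprayC (l : E → E → ℝ) (y w : E) : E :=
  (1 / 2 : ℝ) • (metricC l y w).inverse (sprayCovectorC l y w)

/-- The coefficients `N^μ_α = ∂G^μ/∂v^α` of the non-linear connection; `connC l y w X` is the
vector `N^μ_α(y, w) X^α`. -/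
def connC (l : E → E → ℝ) (y w : E) : E →L[ℝ] E :=
  fderiv ℝ (sprayC l y) w

/-- The horizontal derivative of the connection coefficients, `δN^μ_β/δx^α` with
`δ/δx^α = ∂/∂x^α - N^ν_α ∂/∂v^ν`; `horC l y w X Y` is the vector
`(δN^μ_β/δx^α) X^α Y^β`. -/
def horC (l : E → E → ℝ) (y w : E) : E →L[ℝ] E →L[ℝ] E :=
  fderiv ℝ (fun x : E => connC l x w) y - (fderiv ℝ (connC l y) w).comp (connC l y w)

/-- The curvature `R^μ_{αβ} = δN^μ_β/δx^α - δN^μ_α/δx^β` of the non-linear connection;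
`curvC l y w X Y` is the vector `R^μ_{αβ}(y, w) X^α Y^β`. -/
def curvC (l : E → E → ℝ) (y w : E) : E →L[ℝ] E →L[ℝ] E :=
  horC l y w - (horC l y w).flip

end Coordinates

/-! ## Objects on the manifold

For an object at the point `p` the coordinate expression is taken in the preferred chart at `p`.
In the induced chart of `TM` the coordinates of a vector of `T_pM` are this vector itself, because
Mathlib's `TangentSpace 𝓘(ℝ, E) p` is the space `E` read through the preferred chart at `p`. -/

section Manifold

variable {E : Type*} [NormedAddCommGroup E] [NormedSpace ℝ E]
  {M : Type*} [TopologicalSpace M] [ChartedSpace E M] [IsManifold 𝓘(ℝ, E) ∞ M]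

/-- The velocity coordinates of an element of `TM` in the chart of `TM` induced by the preferred
chart at `p`. -/
def velCoord (p : M) (e : TangentBundle 𝓘(ℝ, E) M) : E :=
  (extChartAt 𝓘(ℝ, E).tangent (⟨p, 0⟩ : TangentBundle 𝓘(ℝ, E) M) e).2

/-- The Lagrangian in the chart of `TM` induced by the preferred chart at `p`. -/
def lagC (L : TangentBundle 𝓘(ℝ, E) M → ℝ) (p : M) (y w : E) : ℝ :=
  L ((extChartAt 𝓘(ℝ, E).tangent (⟨p, 0⟩ : TangentBundle 𝓘(ℝ, E) M)).symm (y, w))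

/-- A vector field in the chart of `TM` induced by the preferred chart at `p`. -/
def fieldC (u : ∀ p : M, TangentSpace 𝓘(ℝ, E) p) (p : M) (y : E) : E :=
  velCoord p ⟨(extChartAt 𝓘(ℝ, E) p).symm y, u ((extChartAt 𝓘(ℝ, E) p).symm y)⟩

/-- The Finsler metric `g_v` on `T_pM`, for `v ∈ T_pM`: the Hessian of the Lagrangian along the
fibre. -/
def metric (L : TangentBundle 𝓘(ℝ, E) M → ℝ) (p : M) (v : TangentSpace 𝓘(ℝ, E) p) :
    E →L[ℝ] E →L[ℝ] ℝ :=
  fderiv ℝ (fun w : E => fderiv ℝ (fun w' : E => L (⟨p, w'⟩ : TangentBundle 𝓘(ℝ, E) M)) w) v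

/-- A bilinear form has signature `(-, +, ⋯, +)`, with `n` plus signs. -/
def IsLorentzian (n : ℕ) (g : E →L[ℝ] E →L[ℝ] ℝ) : Prop :=
  ∃ e : Module.Basis (Fin (n + 1)) ℝ E,
    ∀ i j, g (e i) (e j) = if i = j then (if i = 0 then -1 else 1) else 0

/-- `L` is a Lorentz-Finsler Lagrangian on the `n+1`-dimensional manifold `M`. Only its values on
the slit tangent bundle matter. Class `C⁴` is what is needed for the curvature of the non-linear
connection to be defined and continuous. -/
structure IsLorentzFinsler (n : ℕ) (L : TangentBundle 𝓘(ℝ, E) M → ℝ) : Prop where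
  contMDiffOn : ContMDiffOn 𝓘(ℝ, E).tangent 𝓘(ℝ, ℝ) 4 L {e | e.2 ≠ 0}
  homogeneous : ∀ (p : M) (v : TangentSpace 𝓘(ℝ, E) p), v ≠ 0 → ∀ s : ℝ, 0 < s →
    L ⟨p, s • v⟩ = s ^ 2 * L ⟨p, v⟩
  lorentzian : ∀ (p : M) (v : TangentSpace 𝓘(ℝ, E) p), v ≠ 0 → IsLorentzian n (metric L p v)

/-- The coefficients `N^μ_α(p, v)` of the non-linear connection, in the preferred chart at `p`. -/
def conn (L : TangentBundle 𝓘(ℝ, E) M → ℝ) (p : M) (v : TangentSpace 𝓘(ℝ, E) p) : E →L[ℝ] E :=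
  connC (lagC L p) (extChartAt 𝓘(ℝ, E) p p) v

/-- The endomorphism `R_v` of `T_pM`, `(R_v)^α_β = R^α_{βμ}(p, v) v^μ`. -/
def curv (L : TangentBundle 𝓘(ℝ, E) M → ℝ) (p : M) (v : TangentSpace 𝓘(ℝ, E) p) :
    TangentSpace 𝓘(ℝ, E) p →ₗ[ℝ] TangentSpace 𝓘(ℝ, E) p :=
  ((curvC (lagC L p) (extChartAt 𝓘(ℝ, E) p p) v).flip v : E →L[ℝ] E).toLinearMap

/-- `Ric(v) = tr R_v`. -/
def ricci (L : TangentBundle 𝓘(ℝ, E) M → ℝ) (p : M) (v : TangentSpace 𝓘(ℝ, E) p) : ℝ :=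
  LinearMap.trace ℝ (TangentSpace 𝓘(ℝ, E) p) (curv L p v)

/-- The covariant derivative `X ↦ D_X u` at `p`,
`D_X u^α = (∂u^α/∂x^μ + N^α_μ(x, u(x))) X^μ`. -/
def covDeriv (L : TangentBundle 𝓘(ℝ, E) M → ℝ) (u : ∀ p : M, TangentSpace 𝓘(ℝ, E) p) (p : M) :
    TangentSpace 𝓘(ℝ, E) p →ₗ[ℝ] TangentSpace 𝓘(ℝ, E) p :=
  (fderiv ℝ (fieldC u p) (extChartAt 𝓘(ℝ, E) p p) + conn L p (u p) : E →L[ℝ] E).toLinearMap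

/-- `u` is, on the open set `U`, a `C¹` timelike, normalized, geodesic vector field. -/
structure IsTimelikeGeodesicField (L : TangentBundle 𝓘(ℝ, E) M → ℝ) (U : Set M)
    (u : ∀ p : M, TangentSpace 𝓘(ℝ, E) p) : Prop where
  isOpen : IsOpen U
  contMDiffOn : ContMDiffOn 𝓘(ℝ, E) 𝓘(ℝ, E).tangent 1
    (fun p : M => (⟨p, u p⟩ : TangentBundle 𝓘(ℝ, E) M)) U
  normalized : ∀ p ∈ U, metric L p (u p) (u p) (u p) = -1
  geodesic : ∀ p ∈ U, covDeriv L u p (u p) = 0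

/-- The fibre `V_p = ker g_u(u, ·)`, the vectors of `T_pM` orthogonal to `u`. -/
def orthSpace (L : TangentBundle 𝓘(ℝ, E) M → ℝ) (u : ∀ p : M, TangentSpace 𝓘(ℝ, E) p) (p : M) :
    Submodule ℝ (TangentSpace 𝓘(ℝ, E) p) :=
  LinearMap.ker (metric L p (u p) (u p) : E →L[ℝ] ℝ).toLinearMap

/-- `H` is a `C²` hypersurface (near each of its points the zero set of a `C²` function `f` with
nonvanishing differential, so that `T_pH = ker df_p`) and `u` is orthogonal to it:
`ker g_u(u, ·) = T_pH` for all `p ∈ H`. If `u` is timelike then `g_u` is positive definite on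
`T_pH`, that is, `H` is spacelike. -/
def IsOrthogonalHypersurface (L : TangentBundle 𝓘(ℝ, E) M → ℝ)
    (u : ∀ p : M, TangentSpace 𝓘(ℝ, E) p) (H : Set M) : Prop :=
  ∀ p ∈ H, ∃ f : M → ℝ, ContMDiffAt 𝓘(ℝ, E) 𝓘(ℝ, ℝ) 2 f p ∧
    mfderiv 𝓘(ℝ, E) 𝓘(ℝ, ℝ) f p ≠ 0 ∧
    (∀ᶠ q in nhds p, q ∈ H ↔ f q = 0) ∧
    ∀ X : TangentSpace 𝓘(ℝ, E) p,
      X ∈ orthSpace L u p ↔ mfderiv 𝓘(ℝ, E) 𝓘(ℝ, ℝ) f p X = 0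

/-- The projection `P : T_pM → V_p` with kernel `Span(u)`,
`P(X) = X - g_u(u, X) / g_u(u, u) u`. -/
def proj (L : TangentBundle 𝓘(ℝ, E) M → ℝ) (u : ∀ p : M, TangentSpace 𝓘(ℝ, E) p) (p : M) :
    TangentSpace 𝓘(ℝ, E) p →ₗ[ℝ] orthSpace L u p :=
  let φ : TangentSpace 𝓘(ℝ, E) p →ₗ[ℝ] ℝ := (metric L p (u p) (u p) : E →L[ℝ] ℝ).toLinearMap
  LinearMap.codRestrict (orthSpace L u p)
    ((φ (u p))⁻¹ • (φ (u p) • LinearMap.id - φ.smulRight (u p)))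
    (fun X => by
      change φ _ = 0
      simp only [LinearMap.smul_apply, LinearMap.sub_apply, LinearMap.id_apply,
        LinearMap.smulRight_apply, map_smul, map_sub, smul_eq_mul]
      ring)

/-- The Weingarten map `b : V_p → V_p`, `X ↦ D_X u`. The projection only serves to have the right
target: `D_X u` belongs to `V_p`. -/
def weingarten (L : TangentBundle 𝓘(ℝ, E) M → ℝ) (u : ∀ p : M, TangentSpace 𝓘(ℝ, E) p) (p : M) :
    orthSpace L u p →ₗ[ℝ] orthSpace L u p :=
  proj L u p ∘ₗ covDeriv L u p ∘ₗ (orthSpace L u p).subtype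

/-- The endomorphism `R̄ : V_p → V_p`, `X ↦ R_u(X)`. The projection only serves to have the right
target: `R_u(X)` belongs to `V_p`. -/
def curvBar (L : TangentBundle 𝓘(ℝ, E) M → ℝ) (u : ∀ p : M, TangentSpace 𝓘(ℝ, E) p) (p : M) :
    orthSpace L u p →ₗ[ℝ] orthSpace L u p :=
  proj L u p ∘ₗ curv L p (u p) ∘ₗ (orthSpace L u p).subtype

/-- The trace-free part `A - (1/n) tr A Id` of an endomorphism of an `n`-dimensional space. -/
def traceFree (n : ℕ) {V : Type*} [AddCommGroup V] [Module ℝ V] (A : V →ₗ[ℝ] V) : V →ₗ[ℝ] V :=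
  A - ((1 / (n : ℝ)) * LinearMap.trace ℝ V A) • LinearMap.id

/-- The expansion `θ = tr b`. -/
def expansion (L : TangentBundle 𝓘(ℝ, E) M → ℝ) (u : ∀ p : M, TangentSpace 𝓘(ℝ, E) p) (p : M) :
    ℝ :=
  LinearMap.trace ℝ (orthSpace L u p) (weingarten L u p)

/-- The shear `σ̄ = b - (1/n) θ Id`. -/
def shear (n : ℕ) (L : TangentBundle 𝓘(ℝ, E) M → ℝ) (u : ∀ p : M, TangentSpace 𝓘(ℝ, E) p)
    (p : M) : orthSpace L u p →ₗ[ℝ] orthSpace L u p :=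
  weingarten L u p - ((1 / (n : ℝ)) * expansion L u p) • LinearMap.id

/-- `σ² = tr σ̄²`. -/
def shearSq (n : ℕ) (L : TangentBundle 𝓘(ℝ, E) M → ℝ) (u : ∀ p : M, TangentSpace 𝓘(ℝ, E) p)
    (p : M) : ℝ :=
  LinearMap.trace ℝ (orthSpace L u p) (shear n L u p ∘ₗ shear n L u p)

/-! ### Derivatives along an integral curve of `u` -/

/-- The vector field `Y` along the curve `γ` is differentiable at the parameter `s`. -/
def DiffAlongAt (γ : ℝ → M) (Y : ∀ r : ℝ, TangentSpace 𝓘(ℝ, E) (γ r)) (s : ℝ) : Prop :=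
  DifferentiableAt ℝ (fun r : ℝ => velCoord (γ s) ⟨γ r, Y r⟩) s

/-- The flipped derivative `D̃_u Y^α = ∂Y^α/∂x^μ u^μ + N^α_μ(x, u) Y^μ` at `γ s` of a vector field
`Y` along an integral curve `γ` of `u`; the first term is the derivative of the component `Y^α`
along `γ`. -/
def flippedDeriv (L : TangentBundle 𝓘(ℝ, E) M → ℝ) (u : ∀ p : M, TangentSpace 𝓘(ℝ, E) p)
    (γ : ℝ → M) (Y : ∀ r : ℝ, TangentSpace 𝓘(ℝ, E) (γ r)) (s : ℝ) :
    TangentSpace 𝓘(ℝ, E) (γ s) :=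
  (deriv (fun r : ℝ => velCoord (γ s) ⟨γ r, Y r⟩) s + conn L (γ s) (u (γ s)) (Y s) : E)

/-- The derivative `X' = P(D̃_u X)` of a section `X` of `V` along an integral curve of `u`. -/
def sectionDeriv (L : TangentBundle 𝓘(ℝ, E) M → ℝ) (u : ∀ p : M, TangentSpace 𝓘(ℝ, E) p)
    (γ : ℝ → M) (X : ∀ r : ℝ, orthSpace L u (γ r)) (s : ℝ) : orthSpace L u (γ s) :=
  proj L u (γ s) (flippedDeriv L u γ (fun r => (X r : TangentSpace 𝓘(ℝ, E) (γ r))) s)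

/-- The field `A` of endomorphisms of `V` is differentiable at `γ s` along the integral curve `γ`
of `u`, and its derivative there is `A'`, that is, `A'(X) = (A(X))' - A(X')` for all
differentiable sections `X` of `V` along `γ`. -/
def HasEndoDerivAt (L : TangentBundle 𝓘(ℝ, E) M → ℝ) (u : ∀ p : M, TangentSpace 𝓘(ℝ, E) p)
    (γ : ℝ → M) (A : ∀ p : M, orthSpace L u p →ₗ[ℝ] orthSpace L u p) (s : ℝ)
    (A' : orthSpace L u (γ s) →ₗ[ℝ] orthSpace L u (γ s)) : Prop :=
  ∀ X : ∀ r : ℝ, orthSpace L u (γ r),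
    DiffAlongAt γ (fun r => (X r : TangentSpace 𝓘(ℝ, E) (γ r))) s →
    DiffAlongAt γ (fun r => (A (γ r) (X r) : TangentSpace 𝓘(ℝ, E) (γ r))) s ∧
    sectionDeriv L u γ (fun r => A (γ r) (X r)) s - A (γ s) (sectionDeriv L u γ X s) = A' (X s)

end Manifold

end FinslerRaychaudhuri

end

/-! In a fixed chart put `B = Du + N(·, u)`, the matrix of `X ↦ D_X u`. The geodesic equation reads
`B u = 0`, that is `Du u = F` with `F(y) = -N(y, u) u`. Formally, differentiating this in a
direction `e` expresses `D²u(u, e)`, the derivative of `Du e` along `u`, as `F' e - Du(Du e)`.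
Adding the derivative of `N(·, u)` and using the homogeneity of `N` and the symmetry of its fibre
derivative gives `B' = -R_u - B² - N B + B N`. The derivation `D̃_u` acts on endomorphisms by `C ↦
C' + N C - C N`, so the terms with `N` disappear and the Riccati equation remains.

Since `u` is only `C¹`, `D²u` need not exist. `Du` is still differentiable along integral curves
(`hasDerivAt_fderiv_along_integralCurve`): the difference quotients of `u` have derivatives along
the curve that converge uniformly near the given parameter, because `F` is `C¹`.

That `D_X u` and `R_u(X)` are orthogonal to `u` follows from `δL/δx = 0` (`momentum_connC`). By
Euler's theorem `g_u(u, ·)` is the momentum `∂L/∂v` at `u`. Differentiating `L(u) = -1/2` shows that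
the momentum annihilates `D_X u`, and the symmetry of the second derivative of `L` on horizontal
lifts shows that it annihilates the curvature.

The objects at `γ r` are defined in the preferred chart at `γ r`, so the computation in the chart at
`γ s` requires that `Du + N(·, u)` be chart independent. This comes from the transformation law of
the spray, whose second-order term cancels against that of `Du`.

The other two equations are algebra: `tr b` equals the trace of `B` on the whole tangent space,
commutators have trace zero, and `b = σ̄ + (θ/n) Id`. -/

noncomputable section

namespace FinslerRaychaudhuri

open Function Filter Topology

/-! ### Partial derivatives and homogeneous functions -/

section Calculus

variable {E F G : Type*} [NormedAddCommGroup E] [NormedSpace ℝ E]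
  [NormedAddCommGroup F] [NormedSpace ℝ F] [NormedAddCommGroup G] [NormedSpace ℝ G]

/-- The derivative of a function on a product in terms of its partial derivatives. -/
theorem fderiv_uncurry_apply {f : E → F → G} {y : E} {w : F}
    (hf : DifferentiableAt ℝ (uncurry f) (y, w)) (a : E) (b : F) :
    fderiv ℝ (uncurry f) (y, w) (a, b)
      = fderiv ℝ (fun x => f x w) y a + fderiv ℝ (f y) w b := by
  have h1 : HasFDerivAt (fun x => f x w)
      ((fderiv ℝ (uncurry f) (y, w)).comp (ContinuousLinearMap.inl ℝ E F)) y :=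
    HasFDerivAt.comp (g := uncurry f) (f := fun x => (x, w)) y hf.hasFDerivAt
      (hasFDerivAt_prodMk_left y w)
  have h2 : HasFDerivAt (f y)
      ((fderiv ℝ (uncurry f) (y, w)).comp (ContinuousLinearMap.inr ℝ E F)) w :=
    HasFDerivAt.comp (g := uncurry f) (f := fun x => (y, x)) w hf.hasFDerivAt
      (hasFDerivAt_prodMk_right y w)
  rw [h1.fderiv, h2.fderiv]
  simp [← map_add]

theorem differentiableAt_partial_right {f : E → F → G} {y : E} {w : F}
    (hf : DifferentiableAt ℝ (uncurry f) (y, w)) : DifferentiableAt ℝ (f y) w :=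
  DifferentiableAt.comp (g := uncurry f) (f := fun x => (y, x)) w hf (by fun_prop)

theorem contDiffAt_partial_fderiv_right {f : E → F → G} {y : E} {w : F} {m n : ℕ∞ω}
    (hf : ContDiffAt ℝ n (uncurry f) (y, w)) (hmn : m + 1 ≤ n) :
    ContDiffAt ℝ m (uncurry fun y w => fderiv ℝ (f y) w) (y, w) :=
  ContDiffAt.fderiv (f := fun z : E × F => f z.1) (g := Prod.snd)
    (ContDiffAt.comp (g := uncurry f) (f := fun q : (E × F) × F => (q.1.1, q.2)) _
      (by exact hf) (by fun_prop)) contDiffAt_snd hmn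

theorem contDiffAt_partial_fderiv_left {f : E → F → G} {y : E} {w : F} {m n : ℕ∞ω}
    (hf : ContDiffAt ℝ n (uncurry f) (y, w)) (hmn : m + 1 ≤ n) :
    ContDiffAt ℝ m (uncurry fun y w => fderiv ℝ (fun x => f x w) y) (y, w) :=
  ContDiffAt.fderiv (f := fun (z : E × F) x => f x z.2) (g := Prod.fst)
    (ContDiffAt.comp (g := uncurry f) (f := fun q : (E × F) × E => (q.2, q.1.2)) _
      (by exact hf) (by fun_prop)) contDiffAt_fst hmn

/-- Mixed partial derivatives commute. -/
theorem fderiv_partial_comm {f : E → F → G} {y : E} {w : F}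
    (hf : ContDiffAt ℝ 2 (uncurry f) (y, w)) (a : E) (b : F) :
    fderiv ℝ (fun x => fderiv ℝ (f x) w) y a b
      = fderiv ℝ (fun v => fderiv ℝ (fun x => f x v) y) w b a := by
  -- The two mixed partials are the full second derivative on the vectors `(a, 0)` and `(0, b)`, in
  -- either order.
  have hs := (hf.isSymmSndFDerivAt (by simp)).eq (a, 0) (0, b)
  have hev : ∀ᶠ z in 𝓝 (y, w), DifferentiableAt ℝ (uncurry f) z :=
    (hf.eventually (by simp)).mono fun z hz => hz.differentiableAt (by simp)
  have hdd : DifferentiableAt ℝ (fderiv ℝ (uncurry f)) (y, w) :=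
    (hf.fderiv_right (m := 1) (by norm_num)).differentiableAt (by simp)
  have e1 : (fun x => fderiv ℝ (f x) w) =ᶠ[𝓝 y]
      fun x => (fderiv ℝ (uncurry f) (x, w)).comp (ContinuousLinearMap.inr ℝ E F) := by
    have : Tendsto (fun x => (x, w)) (𝓝 y) (𝓝 (y, w)) :=
      (Continuous.prodMk_left w).tendsto y
    filter_upwards [this.eventually hev] with x hx
    ext b
    simp [fderiv_uncurry_apply hx]
  have e2 : (fun v => fderiv ℝ (fun x => f x v) y) =ᶠ[𝓝 w]
      fun v => (fderiv ℝ (uncurry f) (y, v)).comp (ContinuousLinearMap.inl ℝ E F) := by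
    have : Tendsto (fun v => (y, v)) (𝓝 w) (𝓝 (y, w)) :=
      (Continuous.prodMk_right y).tendsto w
    filter_upwards [this.eventually hev] with x hx
    ext b
    simp [fderiv_uncurry_apply hx]
  have h1 : HasFDerivAt (fun x => fderiv ℝ (uncurry f) (x, w))
      ((fderiv ℝ (fderiv ℝ (uncurry f)) (y, w)).comp (ContinuousLinearMap.inl ℝ E F)) y :=
    HasFDerivAt.comp (g := fderiv ℝ (uncurry f)) (f := fun x => (x, w)) y hdd.hasFDerivAt
      (hasFDerivAt_prodMk_left y w)
  have h2 : HasFDerivAt (fun v => fderiv ℝ (uncurry f) (y, v))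
      ((fderiv ℝ (fderiv ℝ (uncurry f)) (y, w)).comp (ContinuousLinearMap.inr ℝ E F)) w :=
    HasFDerivAt.comp (g := fderiv ℝ (uncurry f)) (f := fun x => (y, x)) w hdd.hasFDerivAt
      (hasFDerivAt_prodMk_right y w)
  rw [e1.fderiv_eq, e2.fderiv_eq, (h1.clm_comp (hasFDerivAt_const _ _)).fderiv,
    (h2.clm_comp (hasFDerivAt_const _ _)).fderiv]
  simpa using hs

/-- Euler's theorem on homogeneous functions. -/
theorem fderiv_apply_self_of_homogeneous {f : E → F} {w : E} {k : ℕ}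
    (hf : DifferentiableAt ℝ f w) (hom : ∀ s : ℝ, 0 < s → f (s • w) = s ^ k • f w) :
    fderiv ℝ f w w = (k : ℝ) • f w := by
  have h1 : HasDerivAt (fun s : ℝ => f (s • w)) (fderiv ℝ f w w) 1 := by
    have h0 : HasDerivAt (fun s : ℝ => s • w) ((1 : ℝ) • w) 1 :=
      (hasDerivAt_id (1 : ℝ)).smul_const w
    rw [one_smul] at h0
    exact HasFDerivAt.comp_hasDerivAt (1 : ℝ) (by simpa using hf.hasFDerivAt) h0
  have h2 : HasDerivAt (fun s : ℝ => s ^ k • f w) (((k : ℝ) * 1 ^ (k - 1)) • f w) 1 :=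
    (hasDerivAt_pow k (1 : ℝ)).smul_const _
  have h3 : (fun s : ℝ => f (s • w)) =ᶠ[𝓝 1] fun s : ℝ => s ^ k • f w := by
    filter_upwards [lt_mem_nhds (zero_lt_one' ℝ)] with s hs using hom s hs
  simpa using h1.unique (h2.congr_of_eventuallyEq h3)

/-- The derivative of a homogeneous function is homogeneous, of one degree less. -/
theorem fderiv_smul_of_homogeneous {f : E → F} {w : E} {k : ℕ} {s : ℝ} (hs : 0 < s)
    (hom : ∀ᶠ v in 𝓝 w, f (s • v) = s ^ (k + 1) • f v) :
    fderiv ℝ f (s • w) = s ^ k • fderiv ℝ f w := by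
  have h1 : fderiv ℝ (fun v => f (s • v)) w = s • fderiv ℝ f (s • w) := fderiv_comp_smul s
  have h2 : fderiv ℝ (fun v => s ^ (k + 1) • f v) w = s ^ (k + 1) • fderiv ℝ f w := by
    exact congrFun (fderiv_const_smul_field (s ^ (k + 1)) (f := f)) w
  have h3 : s • fderiv ℝ f (s • w) = s • s ^ k • fderiv ℝ f w := by
    rw [← h1, EventuallyEq.fderiv_eq hom, h2, smul_smul, pow_succ']
  exact smul_right_injective _ hs.ne' h3

end Calculus

/-! ### The geometry of a Lagrangian in one chart -/

section Lagrangian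

variable {E : Type*} [NormedAddCommGroup E] [NormedSpace ℝ E]

/-- A Lagrangian of class `C⁴` on `O × (E ∖ 0)`, positively homogeneous of degree two and regular:
the coordinate expression of a Finsler Lagrangian. -/
structure IsSlitLagrangian (l : E → E → ℝ) (O : Set E) : Prop where
  isOpen : IsOpen O
  contDiffAt : ∀ y ∈ O, ∀ w, w ≠ 0 → ContDiffAt ℝ 4 (uncurry l) (y, w)
  homogeneous : ∀ y ∈ O, ∀ w, w ≠ 0 → ∀ s : ℝ, 0 < s → l y (s • w) = s ^ 2 * l y w
  nondegenerate : ∀ y ∈ O, ∀ w, w ≠ 0 → (metricC l y w).IsInvertible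

namespace IsSlitLagrangian

variable {l : E → E → ℝ} {O : Set E} {y w : E}

theorem eventually_mem (h : IsSlitLagrangian l O) (hy : y ∈ O) (hw : w ≠ 0) :
    ∀ᶠ z : E × E in 𝓝 (y, w), z.1 ∈ O ∧ z.2 ≠ 0 :=
  (h.isOpen.prod isOpen_compl_singleton).mem_nhds ⟨hy, hw⟩

theorem contDiffAt_momentum (h : IsSlitLagrangian l O) (hy : y ∈ O) (hw : w ≠ 0) :
    ContDiffAt ℝ 3 (uncurry fun y w => fderiv ℝ (l y) w) (y, w) :=
  contDiffAt_partial_fderiv_right (h.contDiffAt y hy w hw) (by norm_num)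

theorem contDiffAt_metricC (h : IsSlitLagrangian l O) (hy : y ∈ O) (hw : w ≠ 0) :
    ContDiffAt ℝ 2 (uncurry (metricC l)) (y, w) :=
  contDiffAt_partial_fderiv_right (h.contDiffAt_momentum hy hw) (by norm_num)

theorem contDiffAt_force (h : IsSlitLagrangian l O) (hy : y ∈ O) (hw : w ≠ 0) :
    ContDiffAt ℝ 3 (uncurry fun y w => fderiv ℝ (fun x => l x w) y) (y, w) :=
  contDiffAt_partial_fderiv_left (h.contDiffAt y hy w hw) (by norm_num)

theorem contDiffAt_sprayCovectorC (h : IsSlitLagrangian l O) (hy : y ∈ O) (hw : w ≠ 0) :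
    ContDiffAt ℝ 2 (uncurry (sprayCovectorC l)) (y, w) :=
  ContDiffAt.sub
    (ContDiffAt.clm_apply
      (contDiffAt_partial_fderiv_left (f := fun y w => fderiv ℝ (l y) w)
        (h.contDiffAt_momentum hy hw) (by norm_num)) contDiffAt_snd)
    ((h.contDiffAt_force hy hw).of_le (by norm_num))

/-- The metric and the covector each cost two of the four derivatives, and inversion is smooth at an
invertible operator. So `G` is `C²` and `N` is `C¹`, enough for the curvature. -/
theorem contDiffAt_sprayC [CompleteSpace E] (h : IsSlitLagrangian l O) (hy : y ∈ O) (hw : w ≠ 0) :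
    ContDiffAt ℝ 2 (uncurry (sprayC l)) (y, w) :=
  ContDiffAt.const_smul (1 / 2 : ℝ)
    (ContDiffAt.clm_apply
      (ContDiffAt.comp (y, w) (g := ContinuousLinearMap.inverse) (f := uncurry (metricC l))
        (h.nondegenerate y hy w hw).contDiffAt_map_inverse (h.contDiffAt_metricC hy hw))
      (h.contDiffAt_sprayCovectorC hy hw))

theorem contDiffAt_connC [CompleteSpace E] (h : IsSlitLagrangian l O) (hy : y ∈ O) (hw : w ≠ 0) :
    ContDiffAt ℝ 1 (uncurry (connC l)) (y, w) :=
  contDiffAt_partial_fderiv_right (h.contDiffAt_sprayC hy hw) (by norm_num)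

theorem metricC_symm (h : IsSlitLagrangian l O) (hy : y ∈ O) (hw : w ≠ 0) (a b : E) :
    metricC l y w a b = metricC l y w b a := by
  have : ContDiffAt ℝ 4 (l y) w :=
    ContDiffAt.comp (g := uncurry l) (f := fun v => (y, v)) w (h.contDiffAt y hy w hw)
      (by fun_prop)
  exact (this.isSymmSndFDerivAt (by simp; norm_num)).eq a b

/-- `N` is itself the fibre derivative of `G`, so this is the symmetry of the Hessian of `G`. -/
theorem fderiv_connC_symm [CompleteSpace E] (h : IsSlitLagrangian l O) (hy : y ∈ O) (hw : w ≠ 0)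
    (a b : E) : fderiv ℝ (connC l y) w a b = fderiv ℝ (connC l y) w b a := by
  have : ContDiffAt ℝ 2 (sprayC l y) w :=
    ContDiffAt.comp (g := uncurry (sprayC l)) (f := fun v => (y, v)) w (h.contDiffAt_sprayC hy hw)
      (by fun_prop)
  exact (this.isSymmSndFDerivAt (by simp)).eq a b

theorem momentum_smul (h : IsSlitLagrangian l O) (hy : y ∈ O) (hw : w ≠ 0) {s : ℝ} (hs : 0 < s) :
    fderiv ℝ (l y) (s • w) = s • fderiv ℝ (l y) w := by
  have := fderiv_smul_of_homogeneous (f := l y) (w := w) (k := 1) hs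
    (by filter_upwards [eventually_ne_nhds hw] with v hv using by
          simpa using h.homogeneous y hy v hv s hs)
  simpa using this

theorem metricC_smul (h : IsSlitLagrangian l O) (hy : y ∈ O) (hw : w ≠ 0) {s : ℝ} (hs : 0 < s) :
    metricC l y (s • w) = metricC l y w := by
  have := fderiv_smul_of_homogeneous (f := fun v => fderiv ℝ (l y) v) (w := w) (k := 0) hs
    (by filter_upwards [eventually_ne_nhds hw] with v hv using by
          simpa using h.momentum_smul hy hv hs)
  simpa [metricC] using this

theorem force_smul (h : IsSlitLagrangian l O) (hy : y ∈ O) (hw : w ≠ 0) {s : ℝ} (hs : 0 < s) :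
    fderiv ℝ (fun x => l x (s • w)) y = s ^ 2 • fderiv ℝ (fun x => l x w) y := by
  have e : (fun x => l x (s • w)) =ᶠ[𝓝 y] fun x => s ^ 2 • l x w := by
    filter_upwards [h.isOpen.mem_nhds hy] with x hx using h.homogeneous x hx w hw s hs
  rw [e.fderiv_eq]
  exact congrFun (fderiv_const_smul_field (s ^ 2) (f := fun x => l x w)) y

theorem sprayCovectorC_smul (h : IsSlitLagrangian l O) (hy : y ∈ O) (hw : w ≠ 0) {s : ℝ}
    (hs : 0 < s) : sprayCovectorC l y (s • w) = s ^ 2 • sprayCovectorC l y w := by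
  have e : (fun x => fderiv ℝ (l x) (s • w)) =ᶠ[𝓝 y] fun x => s • fderiv ℝ (l x) w := by
    filter_upwards [h.isOpen.mem_nhds hy] with x hx using h.momentum_smul hx hw hs
  have e' : fderiv ℝ (fun x => s • fderiv ℝ (l x) w) y =
      s • fderiv ℝ (fun x => fderiv ℝ (l x) w) y := congrFun (fderiv_const_smul_field s (f := fun x => fderiv ℝ (l x) w)) y
  rw [sprayCovectorC, e.fderiv_eq, e', h.force_smul hy hw hs, sprayCovectorC, smul_sub]
  simp [smul_smul, pow_two]

/-- The metric has degree zero in the velocity and the covector degree two. Consequently `N` has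
degree one. -/
theorem sprayC_smul (h : IsSlitLagrangian l O) (hy : y ∈ O) (hw : w ≠ 0) {s : ℝ} (hs : 0 < s) :
    sprayC l y (s • w) = s ^ 2 • sprayC l y w := by
  rw [sprayC, h.sprayCovectorC_smul hy hw hs, h.metricC_smul hy hw hs, map_smul, smul_comm, sprayC]

theorem connC_smul (h : IsSlitLagrangian l O) (hy : y ∈ O) (hw : w ≠ 0) {s : ℝ} (hs : 0 < s) :
    connC l y (s • w) = s • connC l y w := by
  have := fderiv_smul_of_homogeneous (f := sprayC l y) (w := w) (k := 1) hs
    (by filter_upwards [eventually_ne_nhds hw] with v hv using by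
          simpa using h.sprayC_smul hy hv hs)
  simpa [connC] using this

theorem fderiv_connC_self [CompleteSpace E] (h : IsSlitLagrangian l O) (hy : y ∈ O) (hw : w ≠ 0) :
    fderiv ℝ (connC l y) w w = connC l y w := by
  simpa using fderiv_apply_self_of_homogeneous (k := 1)
    (differentiableAt_partial_right ((h.contDiffAt_connC hy hw).differentiableAt (by simp)))
    fun s hs => by simpa using h.connC_smul hy hw hs

/-- Euler's theorem for the momentum, which has degree one. It turns orthogonality to `w` into
annihilation by the momentum at `w`. -/
theorem metricC_self (h : IsSlitLagrangian l O) (hy : y ∈ O) (hw : w ≠ 0) :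
    metricC l y w w = fderiv ℝ (l y) w := by
  simpa [metricC] using fderiv_apply_self_of_homogeneous (f := fun v => fderiv ℝ (l y) v) (k := 1)
    (differentiableAt_partial_right (f := fun y w => fderiv ℝ (l y) w)
      ((h.contDiffAt_momentum hy hw).differentiableAt (by simp)))
    fun s hs => by simpa using h.momentum_smul hy hw hs

theorem metricC_self_self (h : IsSlitLagrangian l O) (hy : y ∈ O) (hw : w ≠ 0) :
    metricC l y w w w = 2 * l y w := by
  rw [h.metricC_self hy hw]
  simpa using fderiv_apply_self_of_homogeneous (f := l y) (k := 2)
    (differentiableAt_partial_right ((h.contDiffAt y hy w hw).differentiableAt (by simp)))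
    fun s hs => by simpa using h.homogeneous y hy w hw s hs

theorem metricC_sprayC (h : IsSlitLagrangian l O) (hy : y ∈ O) (hw : w ≠ 0) :
    metricC l y w (sprayC l y w) = (1 / 2 : ℝ) • sprayCovectorC l y w := by
  rw [sprayC, map_smul, (h.nondegenerate y hy w hw).self_apply_inverse]

theorem sprayCovectorC_apply (h : IsSlitLagrangian l O) (hy : y ∈ O) (hw : w ≠ 0) (b : E) :
    sprayCovectorC l y w b = fderiv ℝ (fun v => fderiv ℝ (fun x => l x v) y) w b w
      - fderiv ℝ (fun x => l x w) y b := by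
  rw [← fderiv_partial_comm ((h.contDiffAt y hy w hw).of_le (by norm_num))]
  rfl

/-- Pair `g(G, ·)`, which is half the spray covector, with `w`. The force `∂l/∂x` has degree two, so
the pairing is `½ (2 - 1)` times the force on `w`. -/
theorem momentum_sprayC (h : IsSlitLagrangian l O) (hy : y ∈ O) (hw : w ≠ 0) :
    fderiv ℝ (l y) w (sprayC l y w) = (1 / 2 : ℝ) * fderiv ℝ (fun x => l x w) y w := by
  have e : fderiv ℝ (fun v => fderiv ℝ (fun x => l x v) y) w w
      = (2 : ℝ) • fderiv ℝ (fun x => l x w) y := by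
    simpa using fderiv_apply_self_of_homogeneous (f := fun v => fderiv ℝ (fun x => l x v) y) (k := 2)
      (differentiableAt_partial_right (f := fun y w => fderiv ℝ (fun x => l x w) y)
        ((h.contDiffAt_force hy hw).differentiableAt (by simp)))
      fun s hs => h.force_smul hy hw hs
  rw [← h.metricC_self hy hw, h.metricC_symm hy hw, h.metricC_sprayC hy hw]
  simp only [smul_apply, h.sprayCovectorC_apply hy hw, e, smul_eq_mul]
  ring

/-- The Lagrangian is horizontally constant: `δL/δx = 0`. -/
theorem momentum_connC [CompleteSpace E] (h : IsSlitLagrangian l O) (hy : y ∈ O) (hw : w ≠ 0)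
    (b : E) : fderiv ℝ (l y) w (connC l y w b) = fderiv ℝ (fun x => l x w) y b := by
  have e : (fun v => fderiv ℝ (l y) v (sprayC l y v)) =ᶠ[𝓝 w]
      fun v => (1 / 2 : ℝ) * fderiv ℝ (fun x => l x v) y v := by
    filter_upwards [eventually_ne_nhds hw] with v hv using h.momentum_sprayC hy hv
  have d1 : DifferentiableAt ℝ (fun v => fderiv ℝ (l y) v) w :=
    differentiableAt_partial_right (f := fun y w => fderiv ℝ (l y) w)
      ((h.contDiffAt_momentum hy hw).differentiableAt (by simp))
  have d2 : DifferentiableAt ℝ (sprayC l y) w :=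
    differentiableAt_partial_right ((h.contDiffAt_sprayC hy hw).differentiableAt (by simp))
  have d3 : DifferentiableAt ℝ (fun v => fderiv ℝ (fun x => l x v) y) w :=
    differentiableAt_partial_right (f := fun y w => fderiv ℝ (fun x => l x w) y)
      ((h.contDiffAt_force hy hw).differentiableAt (by simp))
  -- The fibre derivative of `momentum_sprayC` in the direction `b`. The extra term `g(b, G)` is
  -- known from the definition of the spray (`k2`), and subtracting it leaves the claim.
  have key := congrArg (fun T : E →L[ℝ] ℝ => T b)
    ((d1.hasFDerivAt.clm_apply d2.hasFDerivAt).unique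
      (((d3.hasFDerivAt.clm_apply (hasFDerivAt_id w)).const_mul (1 / 2 : ℝ)).congr_of_eventuallyEq e))
  have k2 : metricC l y w b (sprayC l y w) = (1 / 2 : ℝ) *
      (fderiv ℝ (fun v => fderiv ℝ (fun x => l x v) y) w b w - fderiv ℝ (fun x => l x w) y b) := by
    rw [h.metricC_symm hy hw, h.metricC_sprayC hy hw, ← h.sprayCovectorC_apply hy hw]
    rfl
  simp only [add_apply, ContinuousLinearMap.comp_apply,
    ContinuousLinearMap.flip_apply, smul_apply, smul_eq_mul,
    ContinuousLinearMap.id_apply, id_eq] at key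
  change fderiv ℝ (l y) w (connC l y w b) + metricC l y w b (sprayC l y w) = _ at key
  linarith

/-- The curvature of the non-linear connection takes values in the kernel of the momentum. -/
theorem momentum_curvC [CompleteSpace E] (h : IsSlitLagrangian l O) (hy : y ∈ O) (hw : w ≠ 0)
    (a b : E) : fderiv ℝ (l y) w (curvC l y w a b) = 0 := by
  have hL := h.contDiffAt y hy w hw
  have hN : DifferentiableAt ℝ (uncurry (connC l)) (y, w) :=
    (h.contDiffAt_connC hy hw).differentiableAt (by simp)
  have hdd : DifferentiableAt ℝ (fderiv ℝ (uncurry l)) (y, w) :=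
    (hL.fderiv_right (m := 1) (by norm_num)).differentiableAt (by simp)
  -- By `momentum_connC`, `dl` vanishes on the horizontal lift `(b, -N b)` at every nearby point.
  -- Differentiate this along the lift of `a`: the derivative of the lift of `b` is vertical, equal
  -- to minus `horC` on `a`, `b`. The left side is symmetric, so `horC` antisymmetrized is killed by
  -- the momentum.
  have main : ∀ a b : E,
      fderiv ℝ (fderiv ℝ (uncurry l)) (y, w) (a, -connC l y w a) (b, -connC l y w b)
        = fderiv ℝ (l y) w (horC l y w a b) := by
    intro a b
    have e : (fun z : E × E => fderiv ℝ (uncurry l) z (b, -uncurry (connC l) z b))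
        =ᶠ[𝓝 (y, w)] fun _ => 0 := by
      filter_upwards [h.eventually_mem hy hw] with z hz
      have := fderiv_uncurry_apply (f := l) (y := z.1) (w := z.2)
        ((h.contDiffAt z.1 hz.1 z.2 hz.2).differentiableAt (by simp)) b
        (-uncurry (connC l) z b)
      rw [this, map_neg, ← h.momentum_connC hz.1 hz.2]
      simp [uncurry]
    have key := congrArg (fun T : E × E →L[ℝ] ℝ => T (a, -connC l y w a))
      ((hdd.hasFDerivAt.clm_apply ((hasFDerivAt_const b _).prodMk
        (hN.hasFDerivAt.clm_apply (hasFDerivAt_const b _)).neg)).unique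
        ((hasFDerivAt_const (0 : ℝ) (y, w)).congr_of_eventuallyEq e))
    simp only [add_apply, ContinuousLinearMap.comp_apply,
      ContinuousLinearMap.flip_apply, ContinuousLinearMap.prod_apply,
      neg_apply, zero_apply, map_zero, zero_add,
      fderiv_uncurry_apply hN, fderiv_uncurry_apply (hL.differentiableAt (by simp)),
      Pi.neg_apply, map_neg, uncurry_apply_pair] at key
    rw [horC]
    simp only [sub_apply, ContinuousLinearMap.comp_apply, map_sub]
    simp only [map_add, map_neg] at key
    linarith
  have hs := (hL.isSymmSndFDerivAt (by simp; norm_num)).eq (a, -connC l y w a) (b, -connC l y w b)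
  rw [main, main] at hs
  simp only [curvC, sub_apply, ContinuousLinearMap.flip_apply, map_sub, hs,
    sub_self]

end IsSlitLagrangian

end Lagrangian

/-! ### Behaviour under a change of chart -/

section ChartChange

variable {E : Type*} [NormedAddCommGroup E] [NormedSpace ℝ E]
  {l l' : E → E → ℝ} {O O' : Set E} {φ : E → E} {y : E}

theorem momentum_chart_change (h' : IsSlitLagrangian l' O')
    (hl : ∀ v, l y v = l' (φ y) (fderiv ℝ φ y v))
    (hφy : φ y ∈ O') {w : E} (hw : fderiv ℝ φ y w ≠ 0) :
    fderiv ℝ (l y) w = (fderiv ℝ (l' (φ y)) (fderiv ℝ φ y w)).comp (fderiv ℝ φ y) := by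
  have d : DifferentiableAt ℝ (l' (φ y)) (fderiv ℝ φ y w) :=
    differentiableAt_partial_right ((h'.contDiffAt _ hφy _ hw).differentiableAt (by simp))
  have e : l y = fun v => l' (φ y) (fderiv ℝ φ y v) := funext hl
  rw [e]
  exact (d.hasFDerivAt.comp w (fderiv ℝ φ y).hasFDerivAt).fderiv

/-- The Hessian of a function composed with a linear map. -/
theorem fderiv_fderiv_comp_clm {f : E → ℝ} {T : E →L[ℝ] E} {w : E} (hf : ContDiffAt ℝ 2 f (T w))
    (a b : E) : fderiv ℝ (fun v => fderiv ℝ (fun v => f (T v)) v) w a b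
      = fderiv ℝ (fun v => fderiv ℝ f v) (T w) (T a) (T b) := by
  have d : DifferentiableAt ℝ (fun v => fderiv ℝ f v) (T w) :=
    (hf.fderiv_right (m := 1) (by norm_num)).differentiableAt (by simp)
  have e : (fun v => fderiv ℝ (fun v => f (T v)) v) =ᶠ[𝓝 w]
      fun v => (fderiv ℝ f (T v)).comp T := by
    filter_upwards [T.continuous.continuousAt.eventually (hf.eventually (by simp))] with v hv
      using ((hv.differentiableAt (by simp)).hasFDerivAt.comp v T.hasFDerivAt).fderiv
  have key := ((d.hasFDerivAt.comp w T.hasFDerivAt).clm_comp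
    (hasFDerivAt_const T w)).congr_of_eventuallyEq e
  rw [key.fderiv]
  simp

/-- On a fixed fibre the change of velocity coordinates is linear, so the Hessian is tensorial. -/
theorem metricC_chart_change (h' : IsSlitLagrangian l' O')
    (hl : ∀ v, l y v = l' (φ y) (fderiv ℝ φ y v)) (hφy : φ y ∈ O') {w : E}
    (hw : fderiv ℝ φ y w ≠ 0) (a b : E) :
    metricC l y w a b
      = metricC l' (φ y) (fderiv ℝ φ y w) (fderiv ℝ φ y a) (fderiv ℝ φ y b) := by
  have hf : ContDiffAt ℝ 2 (l' (φ y)) (fderiv ℝ φ y w) :=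
    ContDiffAt.comp (g := uncurry l') (f := fun v => (φ y, v)) _
      ((h'.contDiffAt _ hφy _ hw).of_le (by norm_num)) (by fun_prop)
  rw [metricC, funext hl]
  exact fderiv_fderiv_comp_clm hf a b

/-- The non-tensorial transformation law of the spray coefficients. -/
theorem sprayC_chart_change (h : IsSlitLagrangian l O) (h' : IsSlitLagrangian l' O')
    (hl : ∀ᶠ x in 𝓝 y, ∀ v, l x v = l' (φ x) (fderiv ℝ φ x v)) (hy : y ∈ O) (hφy : φ y ∈ O')
    (hφ : ContDiffAt ℝ 2 φ y) (hT : (fderiv ℝ φ y).IsInvertible) {w : E} (hw : w ≠ 0) :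
    fderiv ℝ φ y (sprayC l y w)
      = sprayC l' (φ y) (fderiv ℝ φ y w) + (1 / 2 : ℝ) • fderiv ℝ (fderiv ℝ φ) y w w := by
  have hTw : fderiv ℝ φ y w ≠ 0 := by
    rwa [Ne, map_eq_zero_iff _ hT.injective]
  have hd : DifferentiableAt ℝ φ y := hφ.differentiableAt (by simp)
  have hdd : DifferentiableAt ℝ (fderiv ℝ φ) y :=
    (hφ.fderiv_right (m := 1) (by norm_num)).differentiableAt (by simp)
  have hp : DifferentiableAt ℝ (uncurry fun y w => fderiv ℝ (l' y) w) (φ y, fderiv ℝ φ y w) :=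
    (h'.contDiffAt_momentum hφy hTw).differentiableAt (by simp)
  have hF : DifferentiableAt ℝ (uncurry l') (φ y, fderiv ℝ φ y w) :=
    (h'.contDiffAt _ hφy _ hTw).differentiableAt (by simp)
  have hpair : HasFDerivAt (fun x => (φ x, fderiv ℝ φ x w))
      ((fderiv ℝ φ y).prod ((fderiv ℝ (fderiv ℝ φ) y).flip w)) y := by
    simpa using hd.hasFDerivAt.prodMk (hdd.hasFDerivAt.clm_apply (hasFDerivAt_const w y))
  have e1 : (fun x => fderiv ℝ (l x) w) =ᶠ[𝓝 y]
      fun x => (fderiv ℝ (l' (φ x)) (fderiv ℝ φ x w)).comp (fderiv ℝ φ x) := by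
    filter_upwards [hl, hd.continuousAt.eventually (h'.isOpen.mem_nhds hφy),
      (hdd.continuousAt.clm_apply continuousAt_const).eventually_ne hTw] with x h1 h2 h3
      using momentum_chart_change h' h1 h2 h3
  have k1 := (((hp.hasFDerivAt.comp y hpair).clm_comp hdd.hasFDerivAt).congr_of_eventuallyEq e1)
  have e2 : (fun x => l x w) =ᶠ[𝓝 y] uncurry l' ∘ fun x => (φ x, fderiv ℝ φ x w) :=
    hl.mono fun x hx => hx w
  have k2 := (hF.hasFDerivAt.comp y hpair).congr_of_eventuallyEq e2
  -- The velocity transition `Dφ` depends on the position, which produces `D²φ`. Its contributions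
  -- through the momentum cancel by symmetry; the one through the metric survives.
  have cov : ∀ a, sprayCovectorC l y w a = sprayCovectorC l' (φ y) (fderiv ℝ φ y w) (fderiv ℝ φ y a)
      + metricC l' (φ y) (fderiv ℝ φ y w) (fderiv ℝ (fderiv ℝ φ) y w w) (fderiv ℝ φ y a) := by
    intro a
    have hs : fderiv ℝ (fderiv ℝ φ) y w a = fderiv ℝ (fderiv ℝ φ) y a w :=
      (hφ.isSymmSndFDerivAt (by simp)).eq w a
    rw [sprayCovectorC, k1.fderiv, k2.fderiv]
    simp only [sub_apply, add_apply, ContinuousLinearMap.comp_apply,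
      ContinuousLinearMap.compL_apply, ContinuousLinearMap.flip_apply,
      ContinuousLinearMap.prod_apply, fderiv_uncurry_apply hp, fderiv_uncurry_apply hF, hs,
      sprayCovectorC, metricC]
    ring
  -- Both sides are compared after lowering the index with the nondegenerate metric of the second
  -- chart.
  have inj : Injective (metricC l' (φ y) (fderiv ℝ φ y w)) :=
    (h'.nondegenerate _ hφy _ hTw).injective
  apply inj
  ext b
  obtain ⟨a, rfl⟩ := hT.surjective b
  rw [← metricC_chart_change h' hl.self_of_nhds hφy hTw, h.metricC_sprayC hy hw, map_add,
    h'.metricC_sprayC hφy hTw, map_smul]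
  simp only [smul_apply, add_apply, cov, smul_eq_mul]
  ring

/-- The transformation law of the coefficients of the non-linear connection. -/
theorem connC_chart_change [CompleteSpace E] (h : IsSlitLagrangian l O)
    (h' : IsSlitLagrangian l' O')
    (hl : ∀ᶠ x in 𝓝 y, ∀ v, l x v = l' (φ x) (fderiv ℝ φ x v)) (hy : y ∈ O) (hφy : φ y ∈ O')
    (hφ : ContDiffAt ℝ 2 φ y) (hT : (fderiv ℝ φ y).IsInvertible) {w : E} (hw : w ≠ 0) (a : E) :
    fderiv ℝ φ y (connC l y w a)
      = connC l' (φ y) (fderiv ℝ φ y w) (fderiv ℝ φ y a) + fderiv ℝ (fderiv ℝ φ) y w a := by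
  have hTw : fderiv ℝ φ y w ≠ 0 := by
    rwa [Ne, map_eq_zero_iff _ hT.injective]
  have d1 : DifferentiableAt ℝ (sprayC l y) w :=
    differentiableAt_partial_right ((h.contDiffAt_sprayC hy hw).differentiableAt (by simp))
  have d2 : DifferentiableAt ℝ (sprayC l' (φ y)) (fderiv ℝ φ y w) :=
    differentiableAt_partial_right ((h'.contDiffAt_sprayC hφy hTw).differentiableAt (by simp))
  have e : (fun v => fderiv ℝ φ y (sprayC l y v)) =ᶠ[𝓝 w] fun v =>
      sprayC l' (φ y) (fderiv ℝ φ y v) + (1 / 2 : ℝ) • fderiv ℝ (fderiv ℝ φ) y v v := by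
    filter_upwards [eventually_ne_nhds hw] with v hv
      using sprayC_chart_change h h' hl hy hφy hφ hT hv
  have hs : fderiv ℝ (fderiv ℝ φ) y a w = fderiv ℝ (fderiv ℝ φ) y w a :=
    (hφ.isSymmSndFDerivAt (by simp)).eq a w
  -- Differentiate the law for the spray along the fibre: the quadratic term `½ D²φ(v, v)`
  -- contributes `D²φ(w, a)` by symmetry.
  have k1 := (fderiv ℝ φ y).hasFDerivAt.comp w d1.hasFDerivAt
  have k2 := (d2.hasFDerivAt.comp w (fderiv ℝ φ y).hasFDerivAt).add
    (((fderiv ℝ (fderiv ℝ φ) y).hasFDerivAt.clm_apply (hasFDerivAt_id w)).const_smul (1 / 2 : ℝ))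
  have key := congrArg (fun T : E →L[ℝ] E => T a) (k1.unique (k2.congr_of_eventuallyEq e))
  simp only [add_apply, smul_apply, ContinuousLinearMap.comp_apply,
    ContinuousLinearMap.flip_apply, ContinuousLinearMap.id_apply, id_eq, hs] at key
  rw [connC, connC, key, add_right_inj, ← two_smul ℝ, smul_smul]
  norm_num

/-- The covariant derivative `Du + N(·, u)` does not depend on the chart. -/
theorem covDeriv_chart_change [CompleteSpace E] (h : IsSlitLagrangian l O)
    (h' : IsSlitLagrangian l' O')
    (hl : ∀ᶠ x in 𝓝 y, ∀ v, l x v = l' (φ x) (fderiv ℝ φ x v)) (hy : y ∈ O) (hφy : φ y ∈ O')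
    (hφ : ContDiffAt ℝ 2 φ y) (hT : (fderiv ℝ φ y).IsInvertible) {u u' : E → E}
    (hu : DifferentiableAt ℝ u y) (hu' : DifferentiableAt ℝ u' (φ y))
    (huu' : ∀ᶠ x in 𝓝 y, u' (φ x) = fderiv ℝ φ x (u x)) (hu0 : u y ≠ 0) (a : E) :
    fderiv ℝ φ y (fderiv ℝ u y a + connC l y (u y) a)
      = fderiv ℝ u' (φ y) (fderiv ℝ φ y a) + connC l' (φ y) (u' (φ y)) (fderiv ℝ φ y a) := by
  have hd : DifferentiableAt ℝ φ y := hφ.differentiableAt (by simp)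
  have hdd : DifferentiableAt ℝ (fderiv ℝ φ) y :=
    (hφ.fderiv_right (m := 1) (by norm_num)).differentiableAt (by simp)
  have hs : fderiv ℝ (fderiv ℝ φ) y a (u y) = fderiv ℝ (fderiv ℝ φ) y (u y) a :=
    (hφ.isSymmSndFDerivAt (by simp)).eq a (u y)
  -- Differentiating `u' ∘ φ = Dφ u` yields `D²φ(a, u)`, which cancels the inhomogeneous term in the
  -- law for `N`.
  have key := congrArg (fun T : E →L[ℝ] E => T a)
    ((hu'.hasFDerivAt.comp y hd.hasFDerivAt).unique
      ((hdd.hasFDerivAt.clm_apply hu.hasFDerivAt).congr_of_eventuallyEq huu'))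
  simp only [add_apply, ContinuousLinearMap.comp_apply, ContinuousLinearMap.flip_apply, hs] at key
  rw [key, map_add, connC_chart_change h h' hl hy hφy hφ hT hu0, huu'.self_of_nhds]
  abel

end ChartChange

/-! ### Differentiating `Du` along the flow when `u` is only `C¹` -/

section Riccati

variable {E : Type*} [NormedAddCommGroup E] [NormedSpace ℝ E]

/-- If `u` is `C¹` and `Du u` is strictly differentiable, then `Du` is differentiable along the
integral curves of `u`, although `u` need not be `C²`. -/
theorem hasDerivAt_fderiv_along_integralCurve {u F : E → E} {F' : E →L[ℝ] E} {c : ℝ → E} {s : ℝ}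
    (hu : ContDiffAt ℝ 1 u (c s)) (hF : HasStrictFDerivAt F F' (c s))
    (huF : ∀ᶠ y in 𝓝 (c s), fderiv ℝ u y (u y) = F y)
    (hc : ∀ᶠ r in 𝓝 s, HasDerivAt c (u (c r)) r) (e : E) :
    HasDerivAt (fun r => fderiv ℝ u (c r) e)
      (F' e - fderiv ℝ u (c s) (fderiv ℝ u (c s) e)) s := by
  set A := fderiv ℝ u (c s)
  have hcs : Tendsto c (𝓝 s) (𝓝 (c s)) := hc.self_of_nhds.continuousAt
  have hdiff : ∀ᶠ y in 𝓝 (c s), DifferentiableAt ℝ u y :=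
    (hu.eventually (by simp)).mono fun y hy => hy.differentiableAt (by simp)
  have hAcont : ContinuousAt (fderiv ℝ u) (c s) :=
    (hu.fderiv_right (m := 0) (by norm_num)).continuousAt
  have hstrict : HasStrictFDerivAt u A (c s) := hu.hasStrictFDerivAt (by simp)
  -- The difference quotient in the direction `e`. For `f = u` it is differentiable along `c` for
  -- each small `h ≠ 0`, and tends to `Du e` as `h → 0`.
  let q : (E → E) → ℝ → E → E := fun f h x => h⁻¹ • (f (x + h • e) - f x)
  have shift : Tendsto (fun z : ℝ × E => z.2 + z.1 • e) (𝓝[≠] 0 ×ˢ 𝓝 (c s)) (𝓝 (c s)) := by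
    have : Tendsto (fun z : ℝ × E => z.2 + z.1 • e) (𝓝 (0, c s)) (𝓝 (c s)) := by
      have := (show Continuous fun z : ℝ × E => z.2 + z.1 • e by fun_prop).tendsto (0, c s)
      simpa using this
    rw [nhds_prod_eq] at this
    exact this.mono_left (prod_mono nhdsWithin_le_nhds le_rfl)
  have hne : ∀ᶠ z : ℝ × E in 𝓝[≠] 0 ×ˢ 𝓝 (c s), z.1 ≠ 0 :=
    tendsto_fst.eventually (self_mem_nhdsWithin : ∀ᶠ h : ℝ in 𝓝[≠] 0, h ≠ 0)
  -- Strict differentiability makes the quotient converge jointly in the step and the base point,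
  -- which supplies the uniformity needed to interchange limit and derivative.
  have quot : ∀ {f : E → E} {f' : E →L[ℝ] E}, HasStrictFDerivAt f f' (c s) →
      Tendsto (fun z : ℝ × E => q f z.1 z.2) (𝓝[≠] 0 ×ˢ 𝓝 (c s)) (𝓝 (f' e)) := by
    intro f f' hf
    have h1 : Tendsto (fun z : ℝ × E => (z.2 + z.1 • e, z.2)) (𝓝[≠] 0 ×ˢ 𝓝 (c s))
        (𝓝 (c s, c s)) := shift.prodMk_nhds tendsto_snd
    have h2 := hf.isLittleO.comp_tendsto h1
    have h3 : (fun z : ℝ × E => q f z.1 z.2 - f' e) =o[𝓝[≠] 0 ×ˢ 𝓝 (c s)]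
        fun _ => (1 : ℝ) := by
      have h4 : ((fun z : ℝ × E => z.1⁻¹) : ℝ × E → ℝ) =O[𝓝[≠] 0 ×ˢ 𝓝 (c s)]
        fun z => z.1⁻¹ := Asymptotics.isBigO_refl _ _
      have h5 := h4.smul_isLittleO h2
      refine (h5.congr' ?_ EventuallyEq.rfl).trans_isBigO ?_
      · filter_upwards [hne] with z hz
        simp only [q, comp_apply, add_sub_cancel_left, map_smul]
        rw [smul_sub, smul_smul, inv_mul_cancel₀ hz, one_smul]
      · refine Asymptotics.IsBigO.of_bound ‖e‖ ?_
        filter_upwards [hne] with z hz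
        simp only [comp_apply, add_sub_cancel_left, smul_smul, inv_mul_cancel₀ hz, one_smul,
          norm_one, mul_one, le_refl]
    simpa using ((Asymptotics.isLittleO_one_iff ℝ).1 h3).add_const (f' e)
  have hprod : Tendsto (fun z : ℝ × ℝ => (z.1, c z.2)) (𝓝[≠] 0 ×ˢ 𝓝 s) (𝓝[≠] 0 ×ˢ 𝓝 (c s)) :=
    tendsto_id.prodMap hcs
  refine hasDerivAt_of_tendstoUniformlyOnFilter (l := 𝓝[≠] (0 : ℝ))
    (f := fun h r => q u h (c r))
    (f' := fun h r => q F h (c r) - fderiv ℝ u (c r + h • e) (q u h (c r)))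
    (g' := fun _ => F' e - A (A e)) ?_ ?_ ?_
  · rw [← tendsto_prod_filter_iff]
    have hA : Tendsto (fun z : ℝ × E => fderiv ℝ u (z.2 + z.1 • e)) (𝓝[≠] 0 ×ˢ 𝓝 (c s)) (𝓝 A) :=
      hAcont.tendsto.comp shift
    have hAq : Tendsto (fun z : ℝ × E => fderiv ℝ u (z.2 + z.1 • e) (q u z.1 z.2))
        (𝓝[≠] 0 ×ˢ 𝓝 (c s)) (𝓝 (A (A e))) :=
      ((isBoundedBilinearMap_apply (𝕜 := ℝ) (E := E) (F := E)).continuous.tendsto (A, A e)).comp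
        (hA.prodMk_nhds (quot hstrict))
    exact ((quot hF).comp hprod).sub (hAq.comp hprod)
  · have h1 : ∀ᶠ z : ℝ × E in 𝓝[≠] 0 ×ˢ 𝓝 (c s), DifferentiableAt ℝ u (z.2 + z.1 • e) ∧
        fderiv ℝ u (z.2 + z.1 • e) (u (z.2 + z.1 • e)) = F (z.2 + z.1 • e) :=
      shift.eventually (hdiff.and huF)
    have h2 : ∀ᶠ z : ℝ × E in 𝓝[≠] 0 ×ˢ 𝓝 (c s), DifferentiableAt ℝ u z.2 ∧
        fderiv ℝ u z.2 (u z.2) = F z.2 := tendsto_snd.eventually (hdiff.and huF)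
    filter_upwards [hprod.eventually h1, hprod.eventually h2, hprod.eventually hne,
      tendsto_snd.eventually hc] with z ⟨d1, f1⟩ ⟨d2, f2⟩ hz hcz
    have k1 := d1.hasFDerivAt.comp_hasDerivAt z.2 (hcz.add_const (z.1 • e))
    have k2 := d2.hasFDerivAt.comp_hasDerivAt z.2 hcz
    refine ((k1.sub k2).const_smul z.1⁻¹).congr_deriv ?_
    -- The curve moves with velocity `u (c r)`, but the equation at the displaced point involves `u
    -- (c r + h • e)`. Replacing one by the other costs `h • q u h`, whose image under `Du` yields
    -- the quadratic term.
    have f3 : u (c z.2) = u (c z.2 + z.1 • e) - z.1 • q u z.1 (c z.2) := by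
      simp only [q, smul_smul, mul_inv_cancel₀ hz, one_smul]
      abel
    rw [f2, f3, map_sub, f1, map_smul]
    change _ = q F z.1 (c z.2) - fderiv ℝ u (c z.2 + z.1 • e) (q u z.1 (c z.2))
    rw [smul_sub, smul_sub, smul_smul, inv_mul_cancel₀ hz, one_smul]
    simp only [q, smul_sub]
    abel
  · have h1 : ∀ᶠ r in 𝓝 s, DifferentiableAt ℝ u (c r) := hcs.eventually hdiff
    filter_upwards [h1] with r hr
    have := (hr.hasFDerivAt.hasLineDerivAt e).tendsto_slope_zero
    exact this

end Riccati

/-! ### The Riccati equation in one chart -/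

section RiccatiCoordinates

variable {E : Type*} [NormedAddCommGroup E] [NormedSpace ℝ E]

/-- A curve of operators on a finite-dimensional space is differentiable if it is so pointwise. -/
theorem hasDerivAt_of_hasDerivAt_apply [FiniteDimensional ℝ E] {F : Type*} [NormedAddCommGroup F]
    [NormedSpace ℝ F] {B : ℝ → E →L[ℝ] F} {B' : E →L[ℝ] F} {s : ℝ}
    (h : ∀ e, HasDerivAt (fun r => B r e) (B' e) s) : HasDerivAt B B' s := by
  let b := Module.finBasis ℝ E
  have expand : ∀ T : E →L[ℝ] F,
      T = ∑ i, (LinearMap.toContinuousLinearMap (b.coord i)).smulRight (T (b i)) := by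
    intro T
    ext e
    conv_lhs => rw [← b.sum_repr e]
    simp only [map_sum, map_smul]
    simp
  rw [expand B', funext fun r => expand (B r)]
  refine HasDerivAt.fun_sum fun i _ => ?_
  exact (ContinuousLinearMap.smulRightL ℝ E F
    (LinearMap.toContinuousLinearMap (b.coord i))).hasFDerivAt.comp_hasDerivAt s (h (b i))

/-- The coordinate expression `∂u^α/∂x^μ + N^α_μ(x, u(x))` of the covariant derivative of `u`. -/
def covDerivC (l : E → E → ℝ) (u : E → E) (y : E) : E →L[ℝ] E :=
  fderiv ℝ u y + connC l y (u y)

variable {l : E → E → ℝ} {O : Set E} {u : E → E} {c : ℝ → E} {s : ℝ}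

/-- The Riccati equation in coordinates. -/
theorem hasDerivAt_covDerivC [FiniteDimensional ℝ E] (h : IsSlitLagrangian l O) (hO : c s ∈ O)
    (hu : ContDiffAt ℝ 1 u (c s)) (hu0 : u (c s) ≠ 0)
    (geo : ∀ᶠ y in 𝓝 (c s), covDerivC l u y (u y) = 0)
    (hc : ∀ᶠ r in 𝓝 s, HasDerivAt c (u (c r)) r) :
    HasDerivAt (fun r => covDerivC l u (c r))
      (-(curvC l (c s) (u (c s))).flip (u (c s))
        - (covDerivC l u (c s)).comp (covDerivC l u (c s))
        - (connC l (c s) (u (c s))).comp (covDerivC l u (c s))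
        + (covDerivC l u (c s)).comp (connC l (c s) (u (c s)))) s := by
  have := FiniteDimensional.complete ℝ E
  refine hasDerivAt_of_hasDerivAt_apply fun e => ?_
  have hN : ContDiffAt ℝ 1 (uncurry (connC l)) (c s, u (c s)) := h.contDiffAt_connC hO hu0
  have hNd : DifferentiableAt ℝ (uncurry (connC l)) (c s, u (c s)) :=
    hN.differentiableAt (by simp)
  have hud : DifferentiableAt ℝ u (c s) := hu.differentiableAt (by simp)
  have hNu : ContDiffAt ℝ 1 (fun y => connC l y (u y)) (c s) :=
    ContDiffAt.comp (c s) (g := uncurry (connC l)) (f := fun y => (y, u y)) hN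
      (contDiffAt_id.prodMk hu)
  have hNu' : HasFDerivAt (fun y => connC l y (u y)) ((fderiv ℝ (uncurry (connC l))
      (c s, u (c s))).comp ((ContinuousLinearMap.id ℝ E).prod (fderiv ℝ u (c s)))) (c s) :=
    HasFDerivAt.comp (c s) (g := uncurry (connC l)) (f := fun y => (y, u y)) hNd.hasFDerivAt
      ((hasFDerivAt_id _).prodMk hud.hasFDerivAt)
  have hF : HasStrictFDerivAt (fun y => -(connC l y (u y) (u y))) _ (c s) :=
    ((hNu.hasStrictFDerivAt' hNu' (by simp)).clm_apply (hu.hasStrictFDerivAt (by simp))).neg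
  -- The geodesic equation makes `Du u` equal to `-N(y, u) u`, which is `C¹` although `Du` is only
  -- continuous.
  have k1 := hasDerivAt_fderiv_along_integralCurve hu hF
    (geo.mono fun y hy => eq_neg_of_add_eq_zero_left (by simpa [covDerivC] using hy)) hc e
  have k2 := (hNu'.comp_hasDerivAt s hc.self_of_nhds).clm_apply (hasDerivAt_const s e)
  refine (k1.add k2).congr_deriv ?_
  have g0 : fderiv ℝ u (c s) (u (c s)) = -connC l (c s) (u (c s)) (u (c s)) :=
    eq_neg_of_add_eq_zero_left (by simpa [covDerivC] using geo.self_of_nhds)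
  have hsym := h.fderiv_connC_symm hO hu0
  have hself := h.fderiv_connC_self hO hu0
  -- The vertical derivative of `N` contracted with `u` is `N` again, by symmetry and Euler's
  -- theorem; this is how the terms `N B` and `B N` arise.
  have e1 : ∀ z, fderiv ℝ (connC l (c s)) (u (c s)) z (u (c s)) = connC l (c s) (u (c s)) z := by
    intro z
    rw [hsym, hself]
  simp only [neg_apply, add_apply, ContinuousLinearMap.comp_apply, ContinuousLinearMap.flip_apply,
    ContinuousLinearMap.prod_apply, ContinuousLinearMap.id_apply, sub_apply, curvC, horC, covDerivC,
    fderiv_uncurry_apply hNd, g0, e1, map_add, map_neg, comp_apply, map_zero, add_zero]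
  abel

end RiccatiCoordinates

/-! ### From the manifold to its charts -/

section ManifoldCoordinates

variable {E : Type*} [NormedAddCommGroup E] [NormedSpace ℝ E]
  {M : Type*} [TopologicalSpace M] [ChartedSpace E M] [IsManifold 𝓘(ℝ, E) ∞ M]

theorem velCoord_eq (p q : M) (X : TangentSpace 𝓘(ℝ, E) q) :
    velCoord p ⟨q, X⟩ = tangentCoordChange 𝓘(ℝ, E) q p q X := rfl

theorem tangentCoordChange_inverse {p q m : M} (hp : m ∈ (extChartAt 𝓘(ℝ, E) p).source)
    (hq : m ∈ (extChartAt 𝓘(ℝ, E) q).source) (v : E) :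
    tangentCoordChange 𝓘(ℝ, E) q p m (tangentCoordChange 𝓘(ℝ, E) p q m v) = v := by
  rw [tangentCoordChange_comp ⟨⟨hp, hq⟩, hp⟩, tangentCoordChange_self hp]

theorem isInvertible_tangentCoordChange {p q m : M} (hp : m ∈ (extChartAt 𝓘(ℝ, E) p).source)
    (hq : m ∈ (extChartAt 𝓘(ℝ, E) q).source) :
    (tangentCoordChange 𝓘(ℝ, E) p q m).IsInvertible :=
  ContinuousLinearMap.IsInvertible.of_inverse (g := tangentCoordChange 𝓘(ℝ, E) q p m)
    (by ext v; exact tangentCoordChange_inverse hq hp v)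
    (by ext v; exact tangentCoordChange_inverse hp hq v)

theorem hasFDerivAt_transition {p q m : M} (hp : m ∈ (extChartAt 𝓘(ℝ, E) p).source)
    (hq : m ∈ (extChartAt 𝓘(ℝ, E) q).source) :
    HasFDerivAt (extChartAt 𝓘(ℝ, E) q ∘ (extChartAt 𝓘(ℝ, E) p).symm)
      (tangentCoordChange 𝓘(ℝ, E) p q m) (extChartAt 𝓘(ℝ, E) p m) := by
  have := hasFDerivWithinAt_tangentCoordChange (I := 𝓘(ℝ, E)) (x := p) (y := q) (z := m) ⟨hp, hq⟩
  rwa [modelWithCornersSelf_coe, Set.range_id, hasFDerivWithinAt_univ] at this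

theorem contDiffAt_transition {p q m : M} (hp : m ∈ (extChartAt 𝓘(ℝ, E) p).source)
    (hq : m ∈ (extChartAt 𝓘(ℝ, E) q).source) :
    ContDiffAt ℝ ∞ (extChartAt 𝓘(ℝ, E) q ∘ (extChartAt 𝓘(ℝ, E) p).symm)
      (extChartAt 𝓘(ℝ, E) p m) := by
  have h' : extChartAt 𝓘(ℝ, E) p m
      ∈ ((extChartAt 𝓘(ℝ, E) p).symm ≫ (extChartAt 𝓘(ℝ, E) q)).source := by
    rw [PartialEquiv.trans_source'', PartialEquiv.symm_symm, PartialEquiv.symm_target]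
    exact Set.mem_image_of_mem _ ⟨hp, hq⟩
  have := contDiffWithinAt_ext_coord_change (I := 𝓘(ℝ, E)) (n := ∞) q p h'
  rwa [modelWithCornersSelf_coe, Set.range_id, contDiffWithinAt_univ] at this

theorem mem_extChartAt_tangent_source {p m : M} (hp : m ∈ (extChartAt 𝓘(ℝ, E) p).source)
    (X : TangentSpace 𝓘(ℝ, E) m) : (⟨m, X⟩ : TangentBundle 𝓘(ℝ, E) M) ∈
      (extChartAt 𝓘(ℝ, E).tangent (⟨p, 0⟩ : TangentBundle 𝓘(ℝ, E) M)).source := by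
  rw [extChartAt_source, TangentBundle.mem_chart_source_iff]
  rwa [extChartAt_source] at hp

theorem extChartAt_tangent_coordChange {p m : M} (hp : m ∈ (extChartAt 𝓘(ℝ, E) p).source) (w : E) :
    extChartAt 𝓘(ℝ, E).tangent (⟨p, 0⟩ : TangentBundle 𝓘(ℝ, E) M)
      ⟨m, tangentCoordChange 𝓘(ℝ, E) p m m w⟩ = (extChartAt 𝓘(ℝ, E) p m, w) :=
  Prod.ext rfl (tangentCoordChange_inverse hp (mem_extChartAt_source m) w)

theorem extChartAt_tangent_symm_apply {p m : M} (hp : m ∈ (extChartAt 𝓘(ℝ, E) p).source) (w : E) :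
    (extChartAt 𝓘(ℝ, E).tangent (⟨p, 0⟩ : TangentBundle 𝓘(ℝ, E) M)).symm
      (extChartAt 𝓘(ℝ, E) p m, w) = ⟨m, tangentCoordChange 𝓘(ℝ, E) p m m w⟩ := by
  rw [← extChartAt_tangent_coordChange hp w]
  exact (extChartAt 𝓘(ℝ, E).tangent _).left_inv (mem_extChartAt_tangent_source hp _)

theorem lagC_apply (L : TangentBundle 𝓘(ℝ, E) M → ℝ) {p m : M}
    (hp : m ∈ (extChartAt 𝓘(ℝ, E) p).source) (w : E) :
    lagC L p (extChartAt 𝓘(ℝ, E) p m) w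
      = L ⟨m, tangentCoordChange 𝓘(ℝ, E) p m m w⟩ :=
  congrArg L (extChartAt_tangent_symm_apply hp w)

theorem lagC_self (L : TangentBundle 𝓘(ℝ, E) M → ℝ) (p : M) (w : E) :
    lagC L p (extChartAt 𝓘(ℝ, E) p p) w = L ⟨p, w⟩ := by
  rw [lagC_apply L (mem_extChartAt_source p), tangentCoordChange_self (mem_extChartAt_source p)]

theorem fieldC_apply (u : ∀ p : M, TangentSpace 𝓘(ℝ, E) p) {p m : M}
    (hp : m ∈ (extChartAt 𝓘(ℝ, E) p).source) :
    fieldC u p (extChartAt 𝓘(ℝ, E) p m) = tangentCoordChange 𝓘(ℝ, E) m p m (u m) := by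
  rw [fieldC, (extChartAt 𝓘(ℝ, E) p).left_inv hp]
  rfl

theorem fieldC_self (u : ∀ p : M, TangentSpace 𝓘(ℝ, E) p) (p : M) :
    fieldC u p (extChartAt 𝓘(ℝ, E) p p) = u p := by
  rw [fieldC_apply u (mem_extChartAt_source p)]
  exact tangentCoordChange_self (mem_extChartAt_source p)

theorem metric_eq_metricC (L : TangentBundle 𝓘(ℝ, E) M → ℝ) (p : M) (v : TangentSpace 𝓘(ℝ, E) p) :
    metric L p v = metricC (lagC L p) (extChartAt 𝓘(ℝ, E) p p) v := by
  have : lagC L p (extChartAt 𝓘(ℝ, E) p p) = fun w => L ⟨p, w⟩ := funext (lagC_self L p)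
  change _ = fderiv ℝ (fun w' : E => fderiv ℝ (lagC L p (extChartAt 𝓘(ℝ, E) p p)) w') v
  rw [this]
  rfl

theorem contDiffAt_lagC {n : ℕ} {L : TangentBundle 𝓘(ℝ, E) M → ℝ} (hL : IsLorentzFinsler n L)
    (p : M) {y w : E} (hy : y ∈ (extChartAt 𝓘(ℝ, E) p).target) (hw : w ≠ 0) :
    ContDiffAt ℝ 4 (uncurry (lagC L p)) (y, w) := by
  -- The transition maps of `TM` involve the derivative of those of `M`, so one more order of
  -- smoothness is required of `M`.
  have i1 : IsManifold 𝓘(ℝ, E) (4 + 1) M := IsManifold.of_le (n := ∞) (by norm_cast)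
  have i2 : IsManifold 𝓘(ℝ, E) 4 M := IsManifold.of_le (n := ∞) (by norm_cast)
  have hT := TangentBundle.contMDiffVectorBundle (I := 𝓘(ℝ, E)) (M := M) (n := 4)
  have hsymm := contMDiffOn_extChartAt_symm (I := 𝓘(ℝ, E).tangent) (n := 4)
    (⟨p, 0⟩ : TangentBundle 𝓘(ℝ, E) M)
  have hset : ∀ z ∈ (extChartAt 𝓘(ℝ, E) p).target ×ˢ ({0}ᶜ : Set E),
      z ∈ (extChartAt 𝓘(ℝ, E).tangent (⟨p, 0⟩ : TangentBundle 𝓘(ℝ, E) M)).target ∧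
      ((extChartAt 𝓘(ℝ, E).tangent (⟨p, 0⟩ : TangentBundle 𝓘(ℝ, E) M)).symm z).2 ≠ 0 := by
    rintro ⟨y, w⟩ ⟨hy, hw⟩
    obtain ⟨m, hm, rfl⟩ : ∃ m ∈ (extChartAt 𝓘(ℝ, E) p).source, extChartAt 𝓘(ℝ, E) p m = y :=
      ⟨_, (extChartAt 𝓘(ℝ, E) p).map_target hy, (extChartAt 𝓘(ℝ, E) p).right_inv hy⟩
    have hT := isInvertible_tangentCoordChange hm (mem_extChartAt_source m)
    refine ⟨?_, ?_⟩
    · rw [← extChartAt_tangent_coordChange hm w]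
      exact (extChartAt 𝓘(ℝ, E).tangent _).map_source (mem_extChartAt_tangent_source hm _)
    · rw [extChartAt_tangent_symm_apply hm]
      exact (map_ne_zero_iff _ hT.injective).2 hw
  have hcomp : ContMDiffOn 𝓘(ℝ, E × E) 𝓘(ℝ, ℝ) 4 (uncurry (lagC L p))
      ((extChartAt 𝓘(ℝ, E) p).target ×ˢ {0}ᶜ) :=
    hL.contMDiffOn.comp (hsymm.mono fun z hz => (hset z hz).1) fun z hz => (hset z hz).2
  exact hcomp.contDiffOn.contDiffAt
    (((isOpen_extChartAt_target p).prod isOpen_compl_singleton).mem_nhds ⟨hy, hw⟩)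

theorem contDiffAt_fieldC {L : TangentBundle 𝓘(ℝ, E) M → ℝ} {U : Set M}
    {u : ∀ p : M, TangentSpace 𝓘(ℝ, E) p} (hu : IsTimelikeGeodesicField L U u)
    {p m : M} (hp : m ∈ (extChartAt 𝓘(ℝ, E) p).source) (hm : m ∈ U) :
    ContDiffAt ℝ 1 (fieldC u p) (extChartAt 𝓘(ℝ, E) p m) := by
  have i1 : IsManifold 𝓘(ℝ, E) (1 + 1) M := IsManifold.of_le (n := ∞) (by norm_cast)
  have hT := TangentBundle.contMDiffVectorBundle (I := 𝓘(ℝ, E)) (M := M) (n := 1)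
  have h1 : ContMDiffAt 𝓘(ℝ, E) 𝓘(ℝ, E) 1 (extChartAt 𝓘(ℝ, E) p).symm (extChartAt 𝓘(ℝ, E) p m) :=
    (contMDiffOn_extChartAt_symm p).contMDiffAt
      (extChartAt_target_mem_nhds' ((extChartAt 𝓘(ℝ, E) p).map_source hp))
  have h2 : ContMDiffAt 𝓘(ℝ, E) 𝓘(ℝ, E).tangent 1
      (fun p : M => (⟨p, u p⟩ : TangentBundle 𝓘(ℝ, E) M))
      ((extChartAt 𝓘(ℝ, E) p).symm (extChartAt 𝓘(ℝ, E) p m)) := by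
    rw [(extChartAt 𝓘(ℝ, E) p).left_inv hp]
    exact hu.contMDiffOn.contMDiffAt (hu.isOpen.mem_nhds hm)
  have h3 : ContMDiffAt 𝓘(ℝ, E).tangent 𝓘(ℝ, E × E) 1
      (extChartAt 𝓘(ℝ, E).tangent (⟨p, 0⟩ : TangentBundle 𝓘(ℝ, E) M))
      (⟨(extChartAt 𝓘(ℝ, E) p).symm (extChartAt 𝓘(ℝ, E) p m), u _⟩ :
        TangentBundle 𝓘(ℝ, E) M) := by
    apply contMDiffAt_extChartAt'
    rw [TangentBundle.mem_chart_source_iff, (extChartAt 𝓘(ℝ, E) p).left_inv hp]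
    rwa [extChartAt_source] at hp
  exact (ContMDiffAt.comp (extChartAt 𝓘(ℝ, E) p m) (g := extChartAt 𝓘(ℝ, E).tangent _) h3
    (h2.comp _ h1)).contDiffAt.snd

/-- Pairing `x` with a vector of the orthonormal basis returns a coordinate of `x` up to sign. -/
theorem IsLorentzian.injective {n : ℕ} {g : E →L[ℝ] E →L[ℝ] ℝ} (hg : IsLorentzian n g) :
    Injective g := by
  obtain ⟨e, he⟩ := hg
  rw [injective_iff_map_eq_zero]
  intro x hx
  apply e.repr.injective
  ext j
  have h : g x (e j) = 0 := by rw [hx]; rfl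
  rw [← e.sum_repr x, map_sum, sum_apply, Finset.sum_eq_single j] at h
  · simp only [map_smul, smul_apply, he, if_true] at h
    rcases smul_eq_zero.1 h with h | h
    · simpa using h
    · split_ifs at h <;> norm_num at h
  · intro i _ hij
    simp [he, hij]
  · simp

theorem isInvertible_of_injective [FiniteDimensional ℝ E] {g : E →L[ℝ] E →L[ℝ] ℝ}
    (hg : Injective g) : g.IsInvertible := by
  have hd : Module.finrank ℝ E = Module.finrank ℝ (E →L[ℝ] ℝ) := by
    rw [← (LinearMap.toContinuousLinearMap : (E →ₗ[ℝ] ℝ) ≃ₗ[ℝ] (E →L[ℝ] ℝ)).finrank_eq]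
    exact (Subspace.dual_finrank_eq (K := ℝ) (V := E)).symm
  refine ⟨(LinearEquiv.ofInjectiveOfFinrankEq g.toLinearMap hg hd).toContinuousLinearEquiv, ?_⟩
  ext a b
  rfl

/-- Lets the one-chart results apply in every preferred chart. At another point `m` of the chart
domain, the fibre Hessian is the pullback of the metric at `m` by the invertible coordinate change,
so it stays nondegenerate. -/
theorem isSlitLagrangian_lagC {n : ℕ} [FiniteDimensional ℝ E]
    {L : TangentBundle 𝓘(ℝ, E) M → ℝ} (hL : IsLorentzFinsler n L) (p : M) :
    IsSlitLagrangian (lagC L p) (extChartAt 𝓘(ℝ, E) p).target where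
  isOpen := isOpen_extChartAt_target p
  contDiffAt y hy w hw := contDiffAt_lagC hL p hy hw
  homogeneous y hy w hw s hs := by
    obtain ⟨m, hm, rfl⟩ : ∃ m ∈ (extChartAt 𝓘(ℝ, E) p).source, extChartAt 𝓘(ℝ, E) p m = y :=
      ⟨_, (extChartAt 𝓘(ℝ, E) p).map_target hy, (extChartAt 𝓘(ℝ, E) p).right_inv hy⟩
    have hT := isInvertible_tangentCoordChange hm (mem_extChartAt_source m)
    rw [lagC_apply L hm, lagC_apply L hm, map_smul]
    exact hL.homogeneous m _ ((map_ne_zero_iff _ hT.injective).2 hw) s hs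
  nondegenerate y hy w hw := by
    obtain ⟨m, hm, rfl⟩ : ∃ m ∈ (extChartAt 𝓘(ℝ, E) p).source, extChartAt 𝓘(ℝ, E) p m = y :=
      ⟨_, (extChartAt 𝓘(ℝ, E) p).map_target hy, (extChartAt 𝓘(ℝ, E) p).right_inv hy⟩
    have hT := isInvertible_tangentCoordChange hm (mem_extChartAt_source m)
    have hw' : tangentCoordChange 𝓘(ℝ, E) p m m w ≠ 0 :=
      (map_ne_zero_iff _ hT.injective).2 hw
    have hf : ContDiffAt ℝ 2 (fun v : E => L ⟨m, v⟩) (tangentCoordChange 𝓘(ℝ, E) p m m w) := by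
      rw [← funext (lagC_self L m)]
      exact ContDiffAt.comp (g := uncurry (lagC L m)) (f := fun v => (_, v)) _
        ((contDiffAt_lagC hL m (mem_extChartAt_target m) hw').of_le (by norm_num)) (by fun_prop)
    have key : ∀ a b, metricC (lagC L p) (extChartAt 𝓘(ℝ, E) p m) w a b
        = metric L m (tangentCoordChange 𝓘(ℝ, E) p m m w) (tangentCoordChange 𝓘(ℝ, E) p m m a)
          (tangentCoordChange 𝓘(ℝ, E) p m m b) := by
      intro a b
      rw [metricC, funext (lagC_apply L hm)]
      exact fderiv_fderiv_comp_clm hf a b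
    apply isInvertible_of_injective
    rw [injective_iff_map_eq_zero]
    intro a ha
    apply hT.injective
    rw [map_zero]
    apply (hL.lorentzian m _ hw').injective
    rw [map_zero]
    ext b
    obtain ⟨b, rfl⟩ := hT.surjective b
    rw [← key, ha]
    rfl

end ManifoldCoordinates

/-! ### Consequences of the normalization of `u` -/

section Conservation

variable {E : Type*} [NormedAddCommGroup E] [NormedSpace ℝ E] {l : E → E → ℝ} {O : Set E}
  {u : E → E} {y : E}

/-- If `l(y, u(y))` is constant, then `D_X u` is annihilated by the momentum of `u`. -/
theorem momentum_covDerivC [CompleteSpace E] (h : IsSlitLagrangian l O) (hy : y ∈ O)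
    (hu : DifferentiableAt ℝ u y) (hu0 : u y ≠ 0) {k : ℝ} (hk : ∀ᶠ x in 𝓝 y, l x (u x) = k)
    (a : E) : fderiv ℝ (l y) (u y) (covDerivC l u y a) = 0 := by
  have hL : DifferentiableAt ℝ (uncurry l) (y, u y) :=
    (h.contDiffAt y hy _ hu0).differentiableAt (by simp)
  have k1 : HasFDerivAt (fun x => l x (u x)) _ y :=
    HasFDerivAt.comp y (g := uncurry l) (f := fun x => (x, u x)) hL.hasFDerivAt
      ((hasFDerivAt_id y).prodMk hu.hasFDerivAt)
  have key := congrArg (fun T : E →L[ℝ] ℝ => T a)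
    (k1.unique ((hasFDerivAt_const k y).congr_of_eventuallyEq hk))
  simp only [ContinuousLinearMap.comp_apply, ContinuousLinearMap.prod_apply,
    fderiv_uncurry_apply hL, zero_apply, ContinuousLinearMap.id_apply] at key
  rw [covDerivC, add_apply, map_add, h.momentum_connC hy hu0, add_comm]
  exact key

end Conservation

/-- A property that holds near `q` in `M` holds near its image in a chart. -/
theorem eventually_extChartAt {E : Type*} [NormedAddCommGroup E] [NormedSpace ℝ E]
    {M : Type*} [TopologicalSpace M] [ChartedSpace E M] {p q : M}
    (hp : q ∈ (extChartAt 𝓘(ℝ, E) p).source) {P : E → Prop}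
    (h : ∀ᶠ m in 𝓝 q, P (extChartAt 𝓘(ℝ, E) p m)) :
    ∀ᶠ y in 𝓝 (extChartAt 𝓘(ℝ, E) p q), P y := by
  have h1 := continuousAt_extChartAt_symm' (I := 𝓘(ℝ, E)) hp
  rw [ContinuousAt, (extChartAt 𝓘(ℝ, E) p).left_inv hp] at h1
  filter_upwards [h1.eventually h,
    extChartAt_target_mem_nhds' ((extChartAt 𝓘(ℝ, E) p).map_source hp)] with y hy ht
  rwa [(extChartAt 𝓘(ℝ, E) p).right_inv ht] at hy

/-! ### Orthogonality to `u` and chart independence of `D_X u` -/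

section Orthogonality

variable {E : Type*} [NormedAddCommGroup E] [NormedSpace ℝ E]
  {M : Type*} [TopologicalSpace M] [ChartedSpace E M] [IsManifold 𝓘(ℝ, E) ∞ M]
  {n : ℕ} {L : TangentBundle 𝓘(ℝ, E) M → ℝ} {U : Set M} {u : ∀ p : M, TangentSpace 𝓘(ℝ, E) p}

theorem velCoord_self (p : M) (X : TangentSpace 𝓘(ℝ, E) p) : velCoord p ⟨p, X⟩ = X := by
  rw [velCoord_eq]
  exact tangentCoordChange_self (mem_extChartAt_source p)

theorem covDeriv_apply (p : M) (X : TangentSpace 𝓘(ℝ, E) p) : covDeriv L u p X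
    = covDerivC (lagC L p) (fieldC u p) (extChartAt 𝓘(ℝ, E) p p) X := by
  rw [covDerivC, fieldC_self]
  rfl

theorem IsTimelikeGeodesicField.ne_zero (hu : IsTimelikeGeodesicField L U u) {p : M} (hp : p ∈ U) :
    u p ≠ 0 := by
  intro h
  have := hu.normalized p hp
  rw [h] at this
  have h0 : metric L p 0 (0 : E) (0 : E) = -1 := this
  simp at h0

theorem fieldC_ne_zero (hu : IsTimelikeGeodesicField L U u) {p q : M} (hq : q ∈ U)
    (hp : q ∈ (extChartAt 𝓘(ℝ, E) p).source) :
    fieldC u p (extChartAt 𝓘(ℝ, E) p q) ≠ 0 := by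
  rw [fieldC_apply u hp]
  exact (map_ne_zero_iff _
    (isInvertible_tangentCoordChange (mem_extChartAt_source q) hp).injective).2 (hu.ne_zero hq)

theorem lagC_fieldC {p m : M} (hp : m ∈ (extChartAt 𝓘(ℝ, E) p).source) :
    lagC L p (extChartAt 𝓘(ℝ, E) p m) (fieldC u p (extChartAt 𝓘(ℝ, E) p m)) = L ⟨m, u m⟩ := by
  rw [fieldC_apply u hp, lagC_apply L hp]
  congr 2
  exact tangentCoordChange_inverse (mem_extChartAt_source m) hp _

theorem eventually_mem_source_inter (hu : IsTimelikeGeodesicField L U u) {p q : M} (hq : q ∈ U)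
    (hp : q ∈ (extChartAt 𝓘(ℝ, E) p).source) :
    ∀ᶠ m in 𝓝 q, m ∈ (extChartAt 𝓘(ℝ, E) p).source ∧ m ∈ U :=
  Filter.Eventually.and ((isOpen_extChartAt_source p).mem_nhds hp) (hu.isOpen.mem_nhds hq)

theorem coe_proj (hu : IsTimelikeGeodesicField L U u) {p : M} (hp : p ∈ U)
    (X : TangentSpace 𝓘(ℝ, E) p) :
    (proj L u p X : TangentSpace 𝓘(ℝ, E) p) = X + metric L p (u p) (u p) X • u p := by
  have h1 := hu.normalized p hp
  change (metric L p (u p) (u p) (u p))⁻¹ • (metric L p (u p) (u p) (u p) • X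
    - metric L p (u p) (u p) X • u p) = _
  rw [h1, smul_sub, smul_smul]
  norm_num

theorem coe_proj_of_mem (hu : IsTimelikeGeodesicField L U u) {p : M} (hp : p ∈ U)
    {X : TangentSpace 𝓘(ℝ, E) p} (hX : X ∈ orthSpace L u p) :
    (proj L u p X : TangentSpace 𝓘(ℝ, E) p) = X := by
  have h : metric L p (u p) (u p) X = 0 := hX
  rw [coe_proj hu hp, h, zero_smul, add_zero]

variable [FiniteDimensional ℝ E]

theorem metric_self (hL : IsLorentzFinsler n L) {p : M} {v : TangentSpace 𝓘(ℝ, E) p} (hv : v ≠ 0) :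
    metric L p v v = fderiv ℝ (lagC L p (extChartAt 𝓘(ℝ, E) p p)) v := by
  rw [metric_eq_metricC]
  exact (isSlitLagrangian_lagC hL p).metricC_self (mem_extChartAt_target p) hv

/-- Euler's theorem twice gives `g_v(v, v) = 2 L(v)`, so the normalization says that `L` is constant
along `u`. -/
theorem lagrangian_eq (hL : IsLorentzFinsler n L) (hu : IsTimelikeGeodesicField L U u) {p : M}
    (hp : p ∈ U) : L ⟨p, u p⟩ = -1 / 2 := by
  have h1 := hu.normalized p hp
  have h2 := (isSlitLagrangian_lagC hL p).metricC_self_self (mem_extChartAt_target p)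
    (hu.ne_zero hp)
  rw [metric_eq_metricC] at h1
  have h3 : 2 * L ⟨p, u p⟩ = -1 :=
    (congrArg (2 * ·) (lagC_self L p (u p))).symm.trans (h2.symm.trans h1)
  linarith

/-- `L(u)` is constant and `L` is horizontally constant, so the momentum of `u`, which is `g_u(u,
·)`, kills `D_X u`. -/
theorem covDeriv_mem_orthSpace (hL : IsLorentzFinsler n L) (hu : IsTimelikeGeodesicField L U u)
    {p : M} (hp : p ∈ U) (X : TangentSpace 𝓘(ℝ, E) p) : covDeriv L u p X ∈ orthSpace L u p := by
  have := FiniteDimensional.complete ℝ E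
  have hs := mem_extChartAt_source (I := 𝓘(ℝ, E)) p
  have key := momentum_covDerivC (isSlitLagrangian_lagC hL p) (mem_extChartAt_target p)
    ((contDiffAt_fieldC hu hs hp).differentiableAt (by simp)) (fieldC_ne_zero hu hp hs)
    (k := -1 / 2) (eventually_extChartAt hs
      ((eventually_mem_source_inter hu hp hs).mono fun m hm => by
        rw [lagC_fieldC hm.1, lagrangian_eq hL hu hm.2])) X
  rw [fieldC_self] at key
  change metric L p (u p) (u p) (covDeriv L u p X) = 0
  rw [metric_self hL (hu.ne_zero hp), covDeriv_apply]
  exact key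

theorem curv_mem_orthSpace (hL : IsLorentzFinsler n L) (hu : IsTimelikeGeodesicField L U u)
    {p : M} (hp : p ∈ U) (X : TangentSpace 𝓘(ℝ, E) p) : curv L p (u p) X ∈ orthSpace L u p := by
  have := FiniteDimensional.complete ℝ E
  change metric L p (u p) (u p) (curv L p (u p) X) = 0
  rw [metric_self hL (hu.ne_zero hp)]
  exact (isSlitLagrangian_lagC hL p).momentum_curvC (mem_extChartAt_target p) (hu.ne_zero hp) _ _

theorem coe_weingarten (hL : IsLorentzFinsler n L) (hu : IsTimelikeGeodesicField L U u)
    {p : M} (hp : p ∈ U) (X : orthSpace L u p) :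
    (weingarten L u p X : TangentSpace 𝓘(ℝ, E) p) = covDeriv L u p X :=
  coe_proj_of_mem hu hp (covDeriv_mem_orthSpace hL hu hp X)

theorem coe_curvBar (hL : IsLorentzFinsler n L) (hu : IsTimelikeGeodesicField L U u)
    {p : M} (hp : p ∈ U) (X : orthSpace L u p) :
    (curvBar L u p X : TangentSpace 𝓘(ℝ, E) p) = curv L p (u p) X :=
  coe_proj_of_mem hu hp (curv_mem_orthSpace hL hu hp X)

/-- The covariant derivative of `u` may be computed in any of the preferred charts. -/
theorem velCoord_covDeriv (hL : IsLorentzFinsler n L) (hu : IsTimelikeGeodesicField L U u)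
    {p q : M} (hq : q ∈ U) (hp : q ∈ (extChartAt 𝓘(ℝ, E) p).source) (X : TangentSpace 𝓘(ℝ, E) q) :
    velCoord p ⟨q, covDeriv L u q X⟩
      = covDerivC (lagC L p) (fieldC u p) (extChartAt 𝓘(ℝ, E) p q) (velCoord p ⟨q, X⟩) := by
  have := FiniteDimensional.complete ℝ E
  have hs := mem_extChartAt_source (I := 𝓘(ℝ, E)) q
  set φ : E → E := extChartAt 𝓘(ℝ, E) p ∘ (extChartAt 𝓘(ℝ, E) q).symm with hφdef
  have hφ : ∀ m ∈ (extChartAt 𝓘(ℝ, E) q).source,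
      φ (extChartAt 𝓘(ℝ, E) q m) = extChartAt 𝓘(ℝ, E) p m := fun m hm => by
    rw [hφdef, comp_apply, (extChartAt 𝓘(ℝ, E) q).left_inv hm]
  have hD : ∀ m ∈ (extChartAt 𝓘(ℝ, E) q).source, m ∈ (extChartAt 𝓘(ℝ, E) p).source →
      fderiv ℝ φ (extChartAt 𝓘(ℝ, E) q m) = tangentCoordChange 𝓘(ℝ, E) q p m := fun m h1 h2 =>
    (hasFDerivAt_transition h1 h2).fderiv
  have hev : ∀ᶠ m in 𝓝 q,
      m ∈ (extChartAt 𝓘(ℝ, E) q).source ∧ m ∈ (extChartAt 𝓘(ℝ, E) p).source :=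
    Filter.Eventually.and ((isOpen_extChartAt_source q).mem_nhds hs)
      ((isOpen_extChartAt_source p).mem_nhds hp)
  have hl : ∀ᶠ x in 𝓝 (extChartAt 𝓘(ℝ, E) q q), ∀ v,
      lagC L q x v = lagC L p (φ x) (fderiv ℝ φ x v) := by
    refine eventually_extChartAt hs (hev.mono fun m hm v => ?_)
    rw [hφ m hm.1, hD m hm.1 hm.2, lagC_apply L hm.1, lagC_apply L hm.2,
      tangentCoordChange_comp ⟨⟨hm.1, hm.2⟩, mem_extChartAt_source m⟩]
  have huu : ∀ᶠ x in 𝓝 (extChartAt 𝓘(ℝ, E) q q),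
      fieldC u p (φ x) = fderiv ℝ φ x (fieldC u q x) := by
    refine eventually_extChartAt hs (hev.mono fun m hm => ?_)
    rw [hφ m hm.1, hD m hm.1 hm.2, fieldC_apply u hm.1, fieldC_apply u hm.2]
    exact (tangentCoordChange_comp ⟨⟨mem_extChartAt_source m, hm.1⟩, hm.2⟩).symm
  -- The transition `φ` relates the coordinate expressions of both `L` and `u` near the point, not
  -- only at it, as the derivatives require.
  have key := covDeriv_chart_change (isSlitLagrangian_lagC hL q) (isSlitLagrangian_lagC hL p) hl
    (mem_extChartAt_target q) (by rw [hφ q hs]; exact (extChartAt 𝓘(ℝ, E) p).map_source hp)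
    ((contDiffAt_transition hs hp).of_le (by norm_cast))
    (by rw [hD q hs hp]; exact isInvertible_tangentCoordChange hs hp)
    ((contDiffAt_fieldC hu hs hq).differentiableAt (by simp))
    (by rw [hφ q hs]; exact (contDiffAt_fieldC hu hp hq).differentiableAt (by simp)) huu
    (fieldC_ne_zero hu hq hs) X
  rw [hφ q hs, hD q hs hp] at key
  rw [velCoord_eq, velCoord_eq, covDeriv_apply]
  exact key

end Orthogonality

/-! ### The evolution equations -/

section Evolution

variable {E : Type*} [NormedAddCommGroup E] [NormedSpace ℝ E]
  {M : Type*} [TopologicalSpace M] [ChartedSpace E M] [IsManifold 𝓘(ℝ, E) ∞ M]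
  {n : ℕ} {L : TangentBundle 𝓘(ℝ, E) M → ℝ} {U : Set M} {u : ∀ p : M, TangentSpace 𝓘(ℝ, E) p}
  {γ : ℝ → M} {s : ℝ}

theorem proj_coe (hu : IsTimelikeGeodesicField L U u) {p : M} (hp : p ∈ U) (X : orthSpace L u p) :
    proj L u p X = X :=
  Subtype.ext (coe_proj_of_mem hu hp X.2)

/-- A field of endomorphisms of `V` represented by a differentiable curve `C` of operators in a
chart has the derivative represented by `C' + N C - C N`. -/
theorem hasEndoDerivAt_of_coord {A : ∀ p : M, orthSpace L u p →ₗ[ℝ] orthSpace L u p}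
    {C : ℝ → E →L[ℝ] E} {C' : E →L[ℝ] E} (hC : HasDerivAt C C' s)
    (hA : ∀ᶠ r in 𝓝 s, ∀ X : orthSpace L u (γ r),
      velCoord (γ s) ⟨γ r, (A (γ r) X : TangentSpace 𝓘(ℝ, E) (γ r))⟩
        = C r (velCoord (γ s) ⟨γ r, (X : TangentSpace 𝓘(ℝ, E) (γ r))⟩))
    (hP : ∀ Z : TangentSpace 𝓘(ℝ, E) (γ s),
      A (γ s) (proj L u (γ s) Z) = proj L u (γ s) (C s Z : E))
    {A' : orthSpace L u (γ s) →ₗ[ℝ] orthSpace L u (γ s)}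
    (hA' : ∀ X : orthSpace L u (γ s), proj L u (γ s)
      ((C' + (conn L (γ s) (u (γ s))).comp (C s) - (C s).comp (conn L (γ s) (u (γ s))))
        (X : TangentSpace 𝓘(ℝ, E) (γ s)) : E) = A' X) :
    HasEndoDerivAt L u γ A s A' := by
  intro X hX
  have e : (fun r => velCoord (γ s) ⟨γ r, (A (γ r) (X r) : TangentSpace 𝓘(ℝ, E) (γ r))⟩)
      =ᶠ[𝓝 s] fun r => C r (velCoord (γ s) ⟨γ r, (X r : TangentSpace 𝓘(ℝ, E) (γ r))⟩) :=
    hA.mono fun r hr => hr (X r)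
  have hd := (hC.clm_apply (DifferentiableAt.hasDerivAt hX)).congr_of_eventuallyEq e
  refine ⟨hd.differentiableAt, ?_⟩
  have h1 : velCoord (γ s) ⟨γ s, (X s : TangentSpace 𝓘(ℝ, E) (γ s))⟩
      = (X s : TangentSpace 𝓘(ℝ, E) (γ s)) := velCoord_self _ _
  have h0 : (A (γ s) (X s) : TangentSpace 𝓘(ℝ, E) (γ s))
      = C s (X s : TangentSpace 𝓘(ℝ, E) (γ s)) := by
    have := hA.self_of_nhds (X s)
    rw [h1] at this
    have h2 : velCoord (γ s) ⟨γ s, (A (γ s) (X s) : TangentSpace 𝓘(ℝ, E) (γ s))⟩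
        = (A (γ s) (X s) : TangentSpace 𝓘(ℝ, E) (γ s)) := velCoord_self _ _
    exact h2.symm.trans this
  -- Leibniz rule: the derivative `d` of the section drops out, so the result depends on `X` only
  -- through its value at `s`.
  have key : ∀ x a v d d' : E, v = x → a = C s x → d' = C' v + C s d →
      d' + conn L (γ s) (u (γ s)) a - C s (d + conn L (γ s) (u (γ s)) x)
        = (C' + (conn L (γ s) (u (γ s))).comp (C s) - (C s).comp (conn L (γ s) (u (γ s)))) x := by
    rintro x a v d d' rfl rfl rfl
    simp only [sub_apply, add_apply, ContinuousLinearMap.comp_apply, map_add]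
    abel
  -- As `A` intertwines the projections, both terms carry a single `P`, which can be taken outside
  -- the difference.
  rw [sectionDeriv, sectionDeriv, hP]
  refine (map_sub (proj L u (γ s)) _ _).symm.trans ((congrArg _ ?_).trans (hA' (X s)))
  exact key _ _ _ _ _ h1 h0 hd.deriv

theorem covDeriv_eq (p : M) : covDeriv L u p
    = (covDerivC (lagC L p) (fieldC u p) (extChartAt 𝓘(ℝ, E) p p)).toLinearMap :=
  LinearMap.ext (covDeriv_apply p)

variable [FiniteDimensional ℝ E]

instance finiteDimensional_tangentSpace (p : M) : FiniteDimensional ℝ (TangentSpace 𝓘(ℝ, E) p) :=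
  inferInstanceAs (FiniteDimensional ℝ E)

theorem weingarten_eq_restrict (hL : IsLorentzFinsler n L) (hu : IsTimelikeGeodesicField L U u)
    {p : M} (hp : p ∈ U) : weingarten L u p
      = (covDeriv L u p).restrict fun X _ => covDeriv_mem_orthSpace hL hu hp X := by
  ext X
  exact coe_weingarten hL hu hp X

theorem curvBar_eq_restrict (hL : IsLorentzFinsler n L) (hu : IsTimelikeGeodesicField L U u)
    {p : M} (hp : p ∈ U) : curvBar L u p
      = (curv L p (u p)).restrict fun X _ => curv_mem_orthSpace hL hu hp X := by
  ext X
  exact coe_curvBar hL hu hp X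

/-- `R_u` maps the whole tangent space into `V`, so restricting it to `V` does not change the trace.
-/
theorem trace_curvBar (hL : IsLorentzFinsler n L) (hu : IsTimelikeGeodesicField L U u)
    {p : M} (hp : p ∈ U) : LinearMap.trace ℝ _ (curvBar L u p) = ricci L p (u p) := by
  rw [curvBar_eq_restrict hL hu hp]
  exact LinearMap.trace_restrict_eq_of_forall_mem _ _ (curv_mem_orthSpace hL hu hp) _

theorem trace_weingarten_comp_self (hL : IsLorentzFinsler n L)
    (hu : IsTimelikeGeodesicField L U u) {p : M} (hp : p ∈ U) :
    LinearMap.trace ℝ _ (weingarten L u p ∘ₗ weingarten L u p)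
      = LinearMap.trace ℝ _ (covDeriv L u p ∘ₗ covDeriv L u p) := by
  rw [← LinearMap.trace_restrict_eq_of_forall_mem (orthSpace L u p)
    (covDeriv L u p ∘ₗ covDeriv L u p) fun X => covDeriv_mem_orthSpace hL hu hp _]
  congr 1
  ext X
  change (weingarten L u p (weingarten L u p X) : TangentSpace 𝓘(ℝ, E) p) = _
  rw [coe_weingarten hL hu hp, coe_weingarten hL hu hp]
  rfl

/-- `D u` takes values in `V`, so its trace can be taken on all of `T_qM`, and conjugation carries
it to any chart. Thus `θ` along a curve is the trace of one curve of operators on `E`, without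
reference to the moving spaces `V`. -/
theorem expansion_eq_trace (hL : IsLorentzFinsler n L) (hu : IsTimelikeGeodesicField L U u)
    {p q : M} (hq : q ∈ U) (hp : q ∈ (extChartAt 𝓘(ℝ, E) p).source) : expansion L u q
      = LinearMap.trace ℝ E
        (covDerivC (lagC L p) (fieldC u p) (extChartAt 𝓘(ℝ, E) p q)).toLinearMap := by
  have h1 : expansion L u q = LinearMap.trace ℝ _ (covDeriv L u q) := by
    rw [expansion, weingarten_eq_restrict hL hu hq]
    exact LinearMap.trace_restrict_eq_of_forall_mem _ _ (covDeriv_mem_orthSpace hL hu hq) _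
  obtain ⟨T, hT⟩ := isInvertible_tangentCoordChange (mem_extChartAt_source (I := 𝓘(ℝ, E)) q) hp
  have hT' : ∀ X : E, tangentCoordChange 𝓘(ℝ, E) q p q X = T X := fun X => by rw [← hT]; rfl
  let T' : TangentSpace 𝓘(ℝ, E) q ≃ₗ[ℝ] E := T.toLinearEquiv
  rw [h1, ← LinearMap.trace_conj' (covDeriv L u q) T']
  congr 1
  ext X
  have key := velCoord_covDeriv hL hu hq hp (T'.symm X)
  rw [velCoord_eq, velCoord_eq] at key
  have e : tangentCoordChange 𝓘(ℝ, E) q p q (T'.symm X) = X :=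
    (hT' _).trans (T.apply_symm_apply X)
  rw [e] at key
  exact (hT' _).symm.trans key

theorem finrank_orthSpace (hn : Module.finrank ℝ E = n + 1) (hu : IsTimelikeGeodesicField L U u)
    {p : M} (hp : p ∈ U) : Module.finrank ℝ (orthSpace L u p) = n := by
  let f : Module.Dual ℝ (TangentSpace 𝓘(ℝ, E) p) :=
    (metric L p (u p) (u p) : E →L[ℝ] ℝ).toLinearMap
  have hf : f ≠ 0 := by
    intro h
    have h1 : f (u p) = -1 := hu.normalized p hp
    rw [h] at h1
    norm_num at h1
  have h2 := Module.Dual.finrank_ker_add_one_of_ne_zero hf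
  have h3 : Module.finrank ℝ (TangentSpace 𝓘(ℝ, E) p) = n + 1 := hn
  rw [h3] at h2
  exact Nat.succ_injective h2

/-- Since `D_u u = 0`, the part of `X` along `u` that the projection removes does not contribute. -/
theorem weingarten_proj (hL : IsLorentzFinsler n L) (hu : IsTimelikeGeodesicField L U u)
    {p : M} (hp : p ∈ U) (X : TangentSpace 𝓘(ℝ, E) p) :
    weingarten L u p (proj L u p X) = proj L u p (covDeriv L u p X) := by
  ext
  rw [coe_weingarten hL hu hp, coe_proj hu hp,
    coe_proj_of_mem hu hp (covDeriv_mem_orthSpace hL hu hp X), map_add, map_smul,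
    hu.geodesic p hp, smul_zero, add_zero]

/-- The data of `u` along an integral curve, in the chart at `γ s`. -/
theorem hasDerivAt_covDerivC_along (hL : IsLorentzFinsler n L)
    (hu : IsTimelikeGeodesicField L U u) (hs : γ s ∈ U) (hγ : IsMIntegralCurveAt γ u s) :
    HasDerivAt (fun r => covDerivC (lagC L (γ s)) (fieldC u (γ s)) (extChartAt 𝓘(ℝ, E) (γ s) (γ r)))
      (-(curvC (lagC L (γ s)) (extChartAt 𝓘(ℝ, E) (γ s) (γ s)) (u (γ s))).flip (u (γ s))
        - (covDerivC (lagC L (γ s)) (fieldC u (γ s)) (extChartAt 𝓘(ℝ, E) (γ s) (γ s))).comp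
          (covDerivC (lagC L (γ s)) (fieldC u (γ s)) (extChartAt 𝓘(ℝ, E) (γ s) (γ s)))
        - (conn L (γ s) (u (γ s))).comp
          (covDerivC (lagC L (γ s)) (fieldC u (γ s)) (extChartAt 𝓘(ℝ, E) (γ s) (γ s)))
        + (covDerivC (lagC L (γ s)) (fieldC u (γ s)) (extChartAt 𝓘(ℝ, E) (γ s) (γ s))).comp
          (conn L (γ s) (u (γ s)))) s := by
  have hsrc := mem_extChartAt_source (I := 𝓘(ℝ, E)) (γ s)
  have hev := eventually_mem_source_inter hu hs hsrc
  have hγev := hγ.continuousAt.eventually hev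
  have geo : ∀ᶠ y in 𝓝 (extChartAt 𝓘(ℝ, E) (γ s) (γ s)),
      covDerivC (lagC L (γ s)) (fieldC u (γ s)) y (fieldC u (γ s) y) = 0 := by
    refine eventually_extChartAt hsrc (hev.mono fun m hm => ?_)
    have key := velCoord_covDeriv hL hu hm.2 hm.1 (u m)
    rw [hu.geodesic m hm.2, velCoord_eq, velCoord_eq, ← fieldC_apply u hm.1] at key
    exact key.symm.trans (map_zero _)
  have hc : ∀ᶠ r in 𝓝 s, HasDerivAt (fun r => extChartAt 𝓘(ℝ, E) (γ s) (γ r))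
      (fieldC u (γ s) (extChartAt 𝓘(ℝ, E) (γ s) (γ r))) r := by
    have := IsManifold.of_le (I := 𝓘(ℝ, E)) (M := M) (m := 1) (n := ∞) (by norm_cast)
    filter_upwards [hγ.eventually_hasDerivAt, hγev] with r hr hm
    rw [fieldC_apply u hm.1]
    exact hr
  have key := hasDerivAt_covDerivC (c := fun r => extChartAt 𝓘(ℝ, E) (γ s) (γ r)) (s := s)
    (isSlitLagrangian_lagC hL (γ s)) (mem_extChartAt_target (γ s)) (contDiffAt_fieldC hu hsrc hs)
    (fieldC_ne_zero hu hs hsrc) geo hc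
  rw [fieldC_self] at key
  exact key

theorem eventually_velCoord_weingarten (hL : IsLorentzFinsler n L)
    (hu : IsTimelikeGeodesicField L U u) (hs : γ s ∈ U) (hγ : IsMIntegralCurveAt γ u s) :
    ∀ᶠ r in 𝓝 s, ∀ X : orthSpace L u (γ r),
      velCoord (γ s) ⟨γ r, (weingarten L u (γ r) X : TangentSpace 𝓘(ℝ, E) (γ r))⟩
        = covDerivC (lagC L (γ s)) (fieldC u (γ s)) (extChartAt 𝓘(ℝ, E) (γ s) (γ r))
          (velCoord (γ s) ⟨γ r, (X : TangentSpace 𝓘(ℝ, E) (γ r))⟩) := by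
  filter_upwards [hγ.continuousAt.eventually
    (eventually_mem_source_inter hu hs (mem_extChartAt_source (γ s)))] with r hm X
  rw [coe_weingarten hL hu hm.2, velCoord_covDeriv hL hu hm.2 hm.1]

theorem coord_riccati_rhs_apply (hL : IsLorentzFinsler n L)
    (hu : IsTimelikeGeodesicField L U u) {p : M} (hp : p ∈ U) (X : orthSpace L u p) :
    (-(curvC (lagC L p) (extChartAt 𝓘(ℝ, E) p p) (u p)).flip (u p)
      - (covDerivC (lagC L p) (fieldC u p) (extChartAt 𝓘(ℝ, E) p p)).comp
        (covDerivC (lagC L p) (fieldC u p) (extChartAt 𝓘(ℝ, E) p p)))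
        (X : TangentSpace 𝓘(ℝ, E) p)
      = ((-curvBar L u p - weingarten L u p ∘ₗ weingarten L u p) X : orthSpace L u p).1 := by
  simp only [LinearMap.sub_apply, LinearMap.neg_apply, LinearMap.comp_apply,
    Submodule.coe_sub, Submodule.coe_neg, coe_weingarten hL hu hp, coe_curvBar hL hu hp,
    covDeriv_eq]
  rfl

/-- The Riccati equation `b' = -R̄ - b²`. -/
theorem hasEndoDerivAt_weingarten (hL : IsLorentzFinsler n L)
    (hu : IsTimelikeGeodesicField L U u) (hs : γ s ∈ U) (hγ : IsMIntegralCurveAt γ u s) :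
    HasEndoDerivAt L u γ (weingarten L u) s
      (-curvBar L u (γ s) - weingarten L u (γ s) ∘ₗ weingarten L u (γ s)) := by
  refine hasEndoDerivAt_of_coord (hasDerivAt_covDerivC_along hL hu hs hγ)
    (eventually_velCoord_weingarten hL hu hs hγ) (fun Z => ?_) (fun X => ?_)
  · rw [weingarten_proj hL hu hs, covDeriv_apply]
  -- The terms `N B` and `B N` of the coordinate equation cancel against those of the flipped
  -- derivative.
  · refine (congrArg _ ?_).trans (proj_coe hu hs _)
    rw [← coord_riccati_rhs_apply hL hu hs]
    congr 1
    abel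

/-- The Raychaudhuri equation in the form `θ' = -Ric(u) - tr b²`. -/
theorem hasDerivAt_expansion (hL : IsLorentzFinsler n L)
    (hu : IsTimelikeGeodesicField L U u) (hs : γ s ∈ U) (hγ : IsMIntegralCurveAt γ u s) :
    HasDerivAt (fun r => expansion L u (γ r)) (-ricci L (γ s) (u (γ s))
      - LinearMap.trace ℝ _ (weingarten L u (γ s) ∘ₗ weingarten L u (γ s))) s := by
  let tr : (E →L[ℝ] E) →L[ℝ] ℝ := LinearMap.toContinuousLinearMap
    (LinearMap.trace ℝ E ∘ₗ ContinuousLinearMap.coeLM ℝ)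
  have e : (fun r => expansion L u (γ r)) =ᶠ[𝓝 s] fun r =>
      tr (covDerivC (lagC L (γ s)) (fieldC u (γ s)) (extChartAt 𝓘(ℝ, E) (γ s) (γ r))) := by
    filter_upwards [hγ.continuousAt.eventually
      (eventually_mem_source_inter hu hs (mem_extChartAt_source (γ s)))] with r hm
    exact expansion_eq_trace hL hu hm.2 hm.1
  refine ((tr.hasFDerivAt.comp_hasDerivAt s
    (hasDerivAt_covDerivC_along hL hu hs hγ)).congr_of_eventuallyEq e).congr_deriv ?_
  -- The connection enters the derivative of `B` only through the commutator of `B` and `N`, which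
  -- has trace zero.
  have hcomm : ∀ S T : E →L[ℝ] E, tr (S.comp T) = tr (T.comp S) := fun S T =>
    LinearMap.trace_mul_comm ℝ S.toLinearMap T.toLinearMap
  rw [map_add, map_sub, map_sub, map_neg, hcomm (conn L (γ s) (u (γ s))), sub_add_cancel,
    trace_weingarten_comp_self hL hu hs]
  rw [covDeriv_eq]
  rfl

/-- The derivative of the shear, in terms of the derivative of the expansion. -/
theorem hasEndoDerivAt_shear (hL : IsLorentzFinsler n L)
    (hu : IsTimelikeGeodesicField L U u) (hs : γ s ∈ U) (hγ : IsMIntegralCurveAt γ u s) {θ' : ℝ}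
    (hθ : HasDerivAt (fun r => expansion L u (γ r)) θ' s) :
    HasEndoDerivAt L u γ (shear n L u) s
      (-curvBar L u (γ s) - weingarten L u (γ s) ∘ₗ weingarten L u (γ s)
        - ((1 / (n : ℝ)) * θ') • LinearMap.id) := by
  refine hasEndoDerivAt_of_coord ((hasDerivAt_covDerivC_along hL hu hs hγ).sub
    ((hθ.const_mul (1 / (n : ℝ))).smul_const (ContinuousLinearMap.id ℝ E))) ?_
    (fun Z => ?_) (fun X => ?_)
  · filter_upwards [eventually_velCoord_weingarten hL hu hs hγ] with r hr X
    have key : ∀ (T B : E →L[ℝ] E) (k : ℝ) (x z : E), T z = B (T x) →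
        T (z - k • x) = (B - k • ContinuousLinearMap.id ℝ E) (T x) := by
      intro T B k x z h
      simp [h]
    exact key _ _ _ _ _ (hr X)
  · rw [shear, LinearMap.sub_apply, weingarten_proj hL hu hs, covDeriv_apply,
      LinearMap.smul_apply, LinearMap.id_apply, ← map_smul]
    exact (map_sub (proj L u (γ s)) _ _).symm
  -- Multiples of the identity commute with `N`, so the expansion contributes only through its
  -- ordinary derivative.
  · have key : ∀ (R B N : E →L[ℝ] E) (k k' : ℝ) (x z : E), (R - B.comp B) x = z →
        (R - B.comp B - N.comp B + B.comp N - k' • ContinuousLinearMap.id ℝ E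
          + N.comp (B - k • ContinuousLinearMap.id ℝ E)
          - (B - k • ContinuousLinearMap.id ℝ E).comp N) x = z - k' • x := by
      rintro R B N k k' x z rfl
      simp only [sub_apply, add_apply, smul_apply, ContinuousLinearMap.comp_apply,
        ContinuousLinearMap.id_apply, map_sub, map_smul]
      abel
    refine (congrArg _ ?_).trans (proj_coe hu hs _)
    exact key _ _ _ _ _ _ _ (coord_riccati_rhs_apply hL hu hs X)

/-- Expand `tr (b - k Id)²` with `k = θ/n`; the identity of `V` has trace `n`, so the terms in `θ²`
add up to `-2/n + 1/n`. -/
theorem trace_shear_comp_self (hn : Module.finrank ℝ E = n + 1)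
    (hu : IsTimelikeGeodesicField L U u) {p : M} (hp : p ∈ U) :
    shearSq n L u p = LinearMap.trace ℝ _ (weingarten L u p ∘ₗ weingarten L u p)
      - (1 / (n : ℝ)) * expansion L u p ^ 2 := by
  -- For `n = 0` this relies on the convention `1 / 0 = 0`.
  have hc : (1 / (n : ℝ)) * (1 / (n : ℝ)) * n = 1 / (n : ℝ) := by
    rcases eq_or_ne (n : ℝ) 0 with h | h
    · simp [h]
    · field_simp
  have e : shear n L u p ∘ₗ shear n L u p = weingarten L u p ∘ₗ weingarten L u p
      - (2 * ((1 / (n : ℝ)) * expansion L u p)) • weingarten L u p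
      + ((1 / (n : ℝ)) * expansion L u p) ^ 2 • LinearMap.id := by
    ext1 X
    simp only [shear, LinearMap.comp_apply, LinearMap.sub_apply, LinearMap.add_apply,
      LinearMap.smul_apply, LinearMap.id_apply, map_sub, map_smul]
    module
  rw [shearSq, e, map_add, map_sub, map_smul, map_smul, ← expansion, LinearMap.trace_id,
    finrank_orthSpace hn hu hp]
  simp only [smul_eq_mul]
  linear_combination expansion L u p ^ 2 * hc

/-- Substitute `b² = σ̄² + (2/n) θ σ̄ + (θ/n)² Id`. The last term cancels the `θ²` term of the
Raychaudhuri equation divided by `n`, while `Ric = tr R̄` and `σ² = tr σ̄²` complete the trace-free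
parts. -/
theorem shear_deriv_eq (hL : IsLorentzFinsler n L) (hu : IsTimelikeGeodesicField L U u)
    {p : M} (hp : p ∈ U) :
    -curvBar L u p - weingarten L u p ∘ₗ weingarten L u p
        - ((1 / (n : ℝ)) * (-ricci L p (u p) - shearSq n L u p
          - (1 / (n : ℝ)) * expansion L u p ^ 2)) • LinearMap.id
      = -traceFree n (curvBar L u p) - traceFree n (shear n L u p ∘ₗ shear n L u p)
        - ((2 / (n : ℝ)) * expansion L u p) • shear n L u p := by
  rw [traceFree, traceFree, trace_curvBar hL hu hp, ← shearSq]
  ext1 X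
  simp only [shear, LinearMap.comp_apply, LinearMap.sub_apply, LinearMap.neg_apply,
    LinearMap.smul_apply, LinearMap.id_apply, map_sub, map_smul]
  module

end Evolution

end FinslerRaychaudhuri

end

/-! ### The main theorem -/

theorem mainTheorem3 {E : Type*} [NormedAddCommGroup E] [NormedSpace ℝ E]
    {M : Type*} [TopologicalSpace M] [ChartedSpace E M] [IsManifold 𝓘(ℝ, E) ∞ M]
    (n : ℕ) (hn : Module.finrank ℝ E = n + 1)
    (L : TangentBundle 𝓘(ℝ, E) M → ℝ) (hL : FinslerRaychaudhuri.IsLorentzFinsler n L)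
    (H U : Set M) (hHU : H ⊆ U) (u : ∀ p : M, TangentSpace 𝓘(ℝ, E) p)
    (hu : FinslerRaychaudhuri.IsTimelikeGeodesicField L U u)
    (hH : FinslerRaychaudhuri.IsOrthogonalHypersurface L u H) :
    -- `b` and `R̄` are well defined: `D_X u` and `R_u(X)` are orthogonal to `u`
    (∀ p ∈ U, ∀ X : FinslerRaychaudhuri.orthSpace L u p,
      (FinslerRaychaudhuri.weingarten L u p X : TangentSpace 𝓘(ℝ, E) p) =
        FinslerRaychaudhuri.covDeriv L u p X ∧
      (FinslerRaychaudhuri.curvBar L u p X : TangentSpace 𝓘(ℝ, E) p) =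
        FinslerRaychaudhuri.curv L p (u p) X) ∧
    ∀ (γ : ℝ → M) (s : ℝ), γ s ∈ U → IsMIntegralCurveAt γ u s →
      -- Riccati equation
      FinslerRaychaudhuri.HasEndoDerivAt L u γ (FinslerRaychaudhuri.weingarten L u) s
        (-FinslerRaychaudhuri.curvBar L u (γ s)
          - FinslerRaychaudhuri.weingarten L u (γ s) ∘ₗ
            FinslerRaychaudhuri.weingarten L u (γ s)) ∧
      -- Raychaudhuri equation
      HasDerivAt (fun r : ℝ => FinslerRaychaudhuri.expansion L u (γ r))
        (-FinslerRaychaudhuri.ricci L (γ s) (u (γ s))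
          - FinslerRaychaudhuri.shearSq n L u (γ s)
          - (1 / (n : ℝ)) * FinslerRaychaudhuri.expansion L u (γ s) ^ 2) s ∧
      -- shear equation
      FinslerRaychaudhuri.HasEndoDerivAt L u γ (FinslerRaychaudhuri.shear n L u) s
        (-FinslerRaychaudhuri.traceFree n (FinslerRaychaudhuri.curvBar L u (γ s))
          - FinslerRaychaudhuri.traceFree n
            (FinslerRaychaudhuri.shear n L u (γ s) ∘ₗ FinslerRaychaudhuri.shear n L u (γ s))
          - ((2 / (n : ℝ)) * FinslerRaychaudhuri.expansion L u (γ s)) •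
            FinslerRaychaudhuri.shear n L u (γ s)) := by
  -- `finrank` is zero on infinite-dimensional spaces, so the positive value `n + 1` forces finite
  -- dimension.
  have hfd : FiniteDimensional ℝ E := FiniteDimensional.of_finrank_pos (by omega)
  refine ⟨fun p hp X => ⟨FinslerRaychaudhuri.coe_weingarten hL hu hp X,
    FinslerRaychaudhuri.coe_curvBar hL hu hp X⟩, fun γ s hs hγ => ?_⟩
  have hθ : HasDerivAt (fun r : ℝ => FinslerRaychaudhuri.expansion L u (γ r))
      (-FinslerRaychaudhuri.ricci L (γ s) (u (γ s)) - FinslerRaychaudhuri.shearSq n L u (γ s)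
        - (1 / (n : ℝ)) * FinslerRaychaudhuri.expansion L u (γ s) ^ 2) s := by
    refine (FinslerRaychaudhuri.hasDerivAt_expansion hL hu hs hγ).congr_deriv ?_
    rw [FinslerRaychaudhuri.trace_shear_comp_self hn hu hs]
    ring
  refine ⟨FinslerRaychaudhuri.hasEndoDerivAt_weingarten hL hu hs hγ, hθ, ?_⟩
  rw [← FinslerRaychaudhuri.shear_deriv_eq hL hu hs]
  exact FinslerRaychaudhuri.hasEndoDerivAt_shear hL hu hs hγ hθ
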